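/- A Steiner forest of a finite simple graph $G$ with respect to a set $S=\{(s_1,t_1),\dots,(s_p,t_p)\}$ of pairs of vertices of $G$ (terminal pairs) is a subgraph $F$ of $G$ such that, for every $i\in\{1,\dots,p\}$, the vertices $s_i$ and $t_i$ belong to the same connected component of $F$. The problem Steiner Forest has as input a finite simple graph $G$, a set $S$ of terminal pairs and an integer $k\ge 0$, and asks whether $(G,S)$ has a Steiner forest $F$ with $|E(F)|\le k$. Let $2K_{1,3}$ denote the disjoint union of two copies of the claw $K_{1,3}$ (the star with three leaves); a graph $G$ is $2K_{1,3}$-subgraph-free if it has no subgraph, induced or not, that is isomorphic to $2K_{1,3}$. Steiner Forest, restricted to inputs $(G,S,k)$ in which $G$ is $2K_{1,3}$-subgraph-free, is polynomial-time solvable: there is an algorithm that decides every such input correctly, in a number of steps that is bounded by a polynomial in the size of (the encoding of) the input, with $G$ given by its adjacency matrix, $S$ by a list of pairs, and $k$ in binary. -/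

import Mathlib

/-! ## A machine model with a step count: the textbook WHILE language over binary trees -/

namespace WhileLang

/-- The data of the WHILE language: finite binary trees. -/
inductive Val : Type
  | nil : Val
  | cons : Val → Val → Val

namespace Val

/-- The size of a tree: its number of nodes, leaves included. -/
def size : Val → ℕ
  | nil => 1
  | cons a b => a.size + b.size + 1

/-- The head of a tree (`nil` for the empty tree). -/
def hd : Val → Val
  | nil => nil
  | cons a _ => a

/-- The tail of a tree (`nil` for the empty tree). -/
def tl : Val → Val
  | nil => nil
  | cons _ b => b

/-- A list of trees as a tree. -/
def ofList : List Val → Val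
  | [] => nil
  | a :: l => cons a (ofList l)

/-- A Boolean as a tree; `false` is `nil`. -/
def ofBool : Bool → Val
  | false => nil
  | true => cons nil nil

/-- A natural number in unary. -/
def ofNatUnary (n : ℕ) : Val := ofList (List.replicate n nil)

/-- A natural number in binary, least significant bit first. -/
def ofNatBinary (n : ℕ) : Val := ofList (n.bits.map ofBool)

end Val

/-- A store assigns a tree to every program variable. Variables are named by numbers; a program
mentions only finitely many of them. -/
abbrev Store := ℕ → Val

/-- Expressions. -/
inductive Expr : Type
  | var : ℕ → Expr
  | nil : Expr
  | cons : Expr → Expr → Expr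
  | hd : Expr → Expr
  | tl : Expr → Expr

namespace Expr

/-- The value of an expression in a store. -/
def eval (s : Store) : Expr → Val
  | var x => s x
  | nil => Val.nil
  | cons e f => Val.cons (e.eval s) (f.eval s)
  | hd e => (e.eval s).hd
  | tl e => (e.eval s).tl

/-- The number of elementary steps (reading a variable, creating a constant, allocating one cell,
following one pointer) in the evaluation of an expression. -/
def cost : Expr → ℕ
  | var _ => 1
  | nil => 1
  | cons e f => e.cost + f.cost + 1
  | hd e => e.cost + 1
  | tl e => e.cost + 1

end Expr

/-- Programs: assignment, sequencing, branching and iteration. A test is an expression, which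
counts as true if its value is not `nil`. -/
inductive Cmd : Type
  | assign : ℕ → Expr → Cmd
  | seq : Cmd → Cmd → Cmd
  | cond : Expr → Cmd → Cmd → Cmd
  | loop : Expr → Cmd → Cmd

/-- `Run c s s' t`: the program `c`, started in the store `s`, halts in the store `s'` after
exactly `t` elementary steps. Each step allocates at most one cell (trees are shared, not copied)
and only the root of a tree can be inspected, so that this is a pointer machine, polynomially
equivalent to Turing machines. -/
inductive Run : Cmd → Store → Store → ℕ → Prop
  | assign (x : ℕ) (e : Expr) (s : Store) :
      Run (Cmd.assign x e) s (Function.update s x (e.eval s)) (e.cost + 1)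
  | seq {c d : Cmd} {s s' s'' : Store} {t u : ℕ} (hc : Run c s s' t) (hd : Run d s' s'' u) :
      Run (Cmd.seq c d) s s'' (t + u)
  | cond_true {e : Expr} {c d : Cmd} {s s' : Store} {t : ℕ} (he : e.eval s ≠ Val.nil)
      (hc : Run c s s' t) : Run (Cmd.cond e c d) s s' (e.cost + 1 + t)
  | cond_false {e : Expr} {c d : Cmd} {s s' : Store} {t : ℕ} (he : e.eval s = Val.nil)
      (hd : Run d s s' t) : Run (Cmd.cond e c d) s s' (e.cost + 1 + t)
  | loop_true {e : Expr} {c : Cmd} {s s' s'' : Store} {t u : ℕ} (he : e.eval s ≠ Val.nil)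
      (hc : Run c s s' t) (hl : Run (Cmd.loop e c) s' s'' u) :
      Run (Cmd.loop e c) s s'' (e.cost + 1 + t + u)
  | loop_false {e : Expr} {c : Cmd} {s : Store} (he : e.eval s = Val.nil) :
      Run (Cmd.loop e c) s s (e.cost + 1)

/-- The initial store: the input in variable `0`, all other variables `nil`. -/
def initStore (v : Val) : Store := fun x => if x = 0 then v else Val.nil

/-- The decision problem with yes-instances `yes` is polynomial-time solvable on the instances in
`dom`, with respect to the encoding `enc`: one fixed program halts on every such instance within a
number of steps that is polynomial in the size of the encoding, and answers correctly (the answer is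
in variable `0`, where `nil` means no). -/
def PolyTimeSolvableOn {α : Type} (enc : α → Val) (dom yes : α → Prop) : Prop :=
  ∃ (c : Cmd) (p : Polynomial ℕ), ∀ a : α, dom a →
    ∃ (s : Store) (t : ℕ), Run c (initStore (enc a)) s t ∧ t ≤ p.eval (enc a).size ∧
      (s 0 ≠ Val.nil ↔ yes a)

end WhileLang

/-! ## Steiner forests -/

/-- `F` is a Steiner forest of `(G, S)`: a subgraph of `G` such that both terminals of each pair lie
in the same connected component of `F`. -/
def IsSteinerForest {V : Type} (G : SimpleGraph V) (S : List (V × V)) (F : G.Subgraph) : Prop :=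
  ∀ p ∈ S, ∃ (hs : p.1 ∈ F.verts) (ht : p.2 ∈ F.verts),
    F.coe.Reachable ⟨p.1, hs⟩ ⟨p.2, ht⟩

/-- An instance of Steiner Forest: a finite graph, a list of terminal pairs, an edge budget. -/
structure SteinerInstance : Type where
  /-- the number of vertices -/
  n : ℕ
  /-- the graph -/
  graph : SimpleGraph (Fin n)
  /-- the terminal pairs -/
  pairs : List (Fin n × Fin n)
  /-- the edge budget -/
  k : ℕ

namespace SteinerInstance

/-- The question: is there a Steiner forest with at most `k` edges? -/
def IsYes (I : SteinerInstance) : Prop :=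
  ∃ F : I.graph.Subgraph, IsSteinerForest I.graph I.pairs F ∧ F.edgeSet.ncard ≤ I.k

open Classical in
/-- The rows of the adjacency matrix of the graph. -/
noncomputable def adjMatrixRows (I : SteinerInstance) : List (List Bool) :=
  List.ofFn fun i : Fin I.n => List.ofFn fun j : Fin I.n => decide (I.graph.Adj i j)

/-- The encoding of an instance: the adjacency matrix, the list of terminal pairs (a vertex is
written as its index in unary), and the edge budget in binary. -/
noncomputable def encode (I : SteinerInstance) : WhileLang.Val :=
  WhileLang.Val.ofList
    [WhileLang.Val.ofList (I.adjMatrixRows.map fun r =>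
        WhileLang.Val.ofList (r.map WhileLang.Val.ofBool)),
      WhileLang.Val.ofList (I.pairs.map fun p =>
        WhileLang.Val.cons (WhileLang.Val.ofNatUnary p.1) (WhileLang.Val.ofNatUnary p.2)),
      WhileLang.Val.ofNatBinary I.k]

end SteinerInstance

/-- The claw `K_{1,3}`. -/
abbrev claw : SimpleGraph (Fin 1 ⊕ Fin 3) := completeBipartiteGraph (Fin 1) (Fin 3)

/-- `2K_{1,3}`, the disjoint union of two claws. -/
abbrev twoClaws : SimpleGraph ((Fin 1 ⊕ Fin 3) ⊕ (Fin 1 ⊕ Fin 3)) := SimpleGraph.sum claw claw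

/-!
Claws of a `2K_{1,3}`-subgraph-free graph `G` pairwise share a vertex. An optimal Steiner forest `F`
is acyclic, so its claws are pairwise intersecting subtrees of a forest and, by the Helly property,
have a common vertex `c`. Boundedly many edges of `G` outside of `F` can be deleted such that `c`
lies in all claws that remain: if some vertex of `G` has degree at least 7, then it lies in all
claws of `G` already; otherwise few vertices are centres of claws, and it suffices to delete the
edges outside of `F` at these.

The algorithm guesses the deleted edges `R` and the vertex `c`. The graph `H = G - R - c` has no
claw, so its components are paths and cycles, and an acyclic subgraph of `H` consists of segments of
paths through these components. Each segment either contains with a terminal also its partners, or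
must be joined to `c` by one edge. The cheapest way to cut a path into such segments is found by
dynamic programming over its suffixes.

Programs are not written down: polynomial-time computability is shown to be preserved by pairing,
composition, branching and structural recursion on lists with values of polynomial size, so that it
can be read off from the definition of a function.
-/

namespace WhileLang

/-- Types whose elements are represented by trees, so that programs can compute with them. Natural
numbers are represented in unary. -/
class TreeEncoding (α : Type) where
  /-- The tree that represents an element. -/
  toVal : α → Val

open TreeEncoding

section TreeEncoding

variable {α β : Type} [TreeEncoding α] [TreeEncoding β]

instance : TreeEncoding Unit := ⟨fun _ => Val.nil⟩

instance : TreeEncoding Bool := ⟨Val.ofBool⟩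

instance : TreeEncoding ℕ := ⟨Val.ofNatUnary⟩

instance : TreeEncoding (α × β) := ⟨fun p => Val.cons (toVal p.1) (toVal p.2)⟩

instance : TreeEncoding (List α) := ⟨fun l => Val.ofList (l.map toVal)⟩

/-- The number of nodes of the tree that represents `a`. -/
def encSize (a : α) : ℕ := (toVal a).size

@[simp]
theorem encSize_mk (a : α) (b : β) : encSize (a, b) = encSize a + encSize b + 1 := rfl

@[simp]
theorem encSize_nil : encSize ([] : List α) = 1 := rfl

@[simp]
theorem encSize_cons (a : α) (l : List α) : encSize (a :: l) = encSize a + encSize l + 1 := rfl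

theorem encSize_bool_le (b : Bool) : encSize b ≤ 3 := by
  cases b <;> decide

@[simp]
theorem encSize_nat (n : ℕ) : encSize n = 2 * n + 1 := by
  induction n with
  | zero => rfl
  | succ n ih =>
    have : encSize (n + 1) = 1 + encSize n + 1 := rfl
    omega

theorem encSize_append (l m : List α) : encSize (l ++ m) + 1 = encSize l + encSize m := by
  induction l with
  | nil => rw [List.nil_append, encSize_nil, add_comm]
  | cons a l ih => rw [List.cons_append, encSize_cons, encSize_cons]; omega

@[simp]
theorem encSize_reverse (l : List α) : encSize l.reverse = encSize l := by
  induction l with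
  | nil => rfl
  | cons a l ih =>
    have := encSize_append l.reverse [a]
    rw [List.reverse_cons]
    simp only [encSize_cons, encSize_nil] at this ⊢
    omega

theorem encSize_le_of_mem {a : α} {l : List α} (h : a ∈ l) : encSize a ≤ encSize l := by
  induction h with
  | head l => rw [encSize_cons]; omega
  | tail b h ih => rw [encSize_cons]; omega

theorem encSize_le_of_sublist {l m : List α} (h : l.Sublist m) : encSize l ≤ encSize m := by
  induction h with
  | slnil => exact le_rfl
  | cons a h ih => rw [encSize_cons]; omega
  | cons_cons a h ih => rw [encSize_cons, encSize_cons]; omega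

theorem length_le_encSize (l : List α) : l.length ≤ encSize l := by
  induction l with
  | nil => exact zero_le_one
  | cons a l ih => rw [encSize_cons, List.length_cons]; omega

theorem encSize_le_of_forall_mem_le {l : List α} {n B : ℕ} (hn : l.length ≤ n)
    (h : ∀ a ∈ l, encSize a ≤ B) : encSize l ≤ n * (B + 1) + 1 := by
  refine le_trans ?_ (Nat.succ_le_succ (Nat.mul_le_mul_right _ hn))
  clear hn
  induction l with
  | nil => simp
  | cons a l ih =>
    have ha := h a List.mem_cons_self
    have hl := ih fun b hb => h b (List.mem_cons_of_mem _ hb)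
    rw [encSize_cons, List.length_cons, Nat.succ_mul]
    omega

theorem encSize_flatten_le (l : List (List α)) : encSize l.flatten ≤ encSize l := by
  induction l with
  | nil => exact le_rfl
  | cons x m ih =>
    have := encSize_append x m.flatten
    rw [List.flatten_cons, encSize_cons]
    omega

end TreeEncoding

section PolyBounded

variable {α β : Type} [TreeEncoding α] [TreeEncoding β]

/-- A quantity that is bounded by a polynomial in the size of the argument. -/
@[fun_prop]
def PolyBounded (T : α → ℕ) : Prop := ∃ p : Polynomial ℕ, ∀ a, T a ≤ p.eval (encSize a)

theorem polynomial_eval_mono (p : Polynomial ℕ) : Monotone fun n => p.eval n := by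
  intro m n h
  simp only [Polynomial.eval_eq_sum]
  exact Finset.sum_le_sum fun i _ => Nat.mul_le_mul_left _ (Nat.pow_le_pow_left h i)

namespace PolyBounded

variable {T U : α → ℕ}

theorem mono (hU : PolyBounded U) (h : ∀ a, T a ≤ U a) : PolyBounded T :=
  let ⟨p, hp⟩ := hU
  ⟨p, fun a => (h a).trans (hp a)⟩

@[fun_prop]
theorem const (n : ℕ) : PolyBounded fun _ : α => n :=
  ⟨Polynomial.C n, fun _ => Polynomial.eval_C.ge⟩

@[fun_prop]
theorem encSize : PolyBounded fun a : α => encSize a :=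
  ⟨Polynomial.X, fun _ => Polynomial.eval_X.ge⟩

@[fun_prop]
theorem add (hT : PolyBounded T) (hU : PolyBounded U) : PolyBounded fun a => T a + U a :=
  let ⟨p, hp⟩ := hT
  let ⟨q, hq⟩ := hU
  ⟨p + q, fun a => by simpa using Nat.add_le_add (hp a) (hq a)⟩

@[fun_prop]
theorem mul (hT : PolyBounded T) (hU : PolyBounded U) : PolyBounded fun a => T a * U a :=
  let ⟨p, hp⟩ := hT
  let ⟨q, hq⟩ := hU
  ⟨p * q, fun a => by simpa using Nat.mul_le_mul (hp a) (hq a)⟩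

theorem polynomial_eval (p : Polynomial ℕ) (hT : PolyBounded T) :
    PolyBounded fun a => p.eval (T a) :=
  let ⟨q, hq⟩ := hT
  ⟨p.comp q, fun a => by simpa [Polynomial.eval_comp] using polynomial_eval_mono p (hq a)⟩

theorem comp {V : β → ℕ} {f : α → β} (hV : PolyBounded V)
    (hf : PolyBounded fun a => WhileLang.encSize (f a)) : PolyBounded fun a => V (f a) :=
  let ⟨p, hp⟩ := hV
  (hf.polynomial_eval p).mono fun a => hp (f a)

end PolyBounded

end PolyBounded

section Evaluates

/-- The program `c`, started in the store `s`, halts with `v` in register `d` after at most `T`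
steps and leaves the registers below `d` unchanged. -/
def Evaluates (c : Cmd) (s : Store) (d : ℕ) (v : Val) (T : ℕ) : Prop :=
  ∃ (s' : Store) (t : ℕ), Run c s s' t ∧ s' d = v ∧ (∀ x < d, s' x = s x) ∧ t ≤ T

namespace Evaluates

variable {c c' : Cmd} {s : Store} {b d : ℕ} {v w : Val} {e : Expr} {T U : ℕ}

theorem mono (h : Evaluates c s d v T) (hTU : T ≤ U) : Evaluates c s d v U :=
  let ⟨s', t, hrun, hv, hlt, ht⟩ := h
  ⟨s', t, hrun, hv, hlt, ht.trans hTU⟩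

theorem assign (h : e.eval s = v) : Evaluates (.assign d e) s d v (e.cost + 1) :=
  ⟨_, _, .assign d e s, by rw [Function.update_self, h],
    fun _ hx => Function.update_of_ne hx.ne _ _, le_rfl⟩

theorem seq (h : Evaluates c s d v T) (hbd : b ≤ d)
    (h' : ∀ s', s' d = v → (∀ x < d, s' x = s x) → Evaluates c' s' b w U) :
    Evaluates (.seq c c') s b w (T + U) := by
  obtain ⟨s₁, t₁, run₁, hv, hlt₁, ht₁⟩ := h
  obtain ⟨s₂, t₂, run₂, hw, hlt₂, ht₂⟩ := h' s₁ hv hlt₁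
  exact ⟨s₂, t₁ + t₂, run₁.seq run₂, hw,
    fun x hx => (hlt₂ x hx).trans (hlt₁ x (hx.trans_le hbd)), Nat.add_le_add ht₁ ht₂⟩

theorem cond_true (he : e.eval s ≠ .nil) (h : Evaluates c s d v T) :
    Evaluates (.cond e c c') s d v (e.cost + 1 + T) :=
  let ⟨s', _, hrun, hv, hlt, ht⟩ := h
  ⟨s', _, .cond_true he hrun, hv, hlt, Nat.add_le_add_left ht _⟩

theorem cond_false (he : e.eval s = .nil) (h : Evaluates c' s d v T) :
    Evaluates (.cond e c c') s d v (e.cost + 1 + T) :=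
  let ⟨s', _, hrun, hv, hlt, ht⟩ := h
  ⟨s', _, .cond_false he hrun, hv, hlt, Nat.add_le_add_left ht _⟩

theorem loop_true (he : e.eval s ≠ .nil) (h : Evaluates c s d v T)
    (h' : ∀ s', s' d = v → Evaluates (.loop e c) s' d w U) :
    Evaluates (.loop e c) s d w (e.cost + 1 + T + U) := by
  obtain ⟨s₁, t₁, run₁, hv, hlt₁, ht₁⟩ := h
  obtain ⟨s₂, t₂, run₂, hw, hlt₂, ht₂⟩ := h' s₁ hv
  exact ⟨s₂, _, .loop_true he run₁ run₂, hw, fun x hx => (hlt₂ x hx).trans (hlt₁ x hx), by omega⟩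

theorem loop_false (he : e.eval s = .nil) : Evaluates (.loop e c) s d (s d) (e.cost + 1) :=
  ⟨s, _, .loop_false he, rfl, fun _ _ => rfl, le_rfl⟩

end Evaluates

end Evaluates

section Computes

variable {α β γ σ : Type} [TreeEncoding α] [TreeEncoding β] [TreeEncoding γ] [TreeEncoding σ]

/-- For every register `b`, the program `c b` replaces an argument of `f` in register `b` by the
value of `f`, within `T` steps; it may overwrite the registers above `b`. -/
def Computes (c : ℕ → Cmd) (f : α → β) (T : α → ℕ) : Prop :=
  ∀ (b : ℕ) (s : Store) (a : α), s b = toVal a → Evaluates (c b) s b (toVal (f a)) (T a)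

/-- The program that runs `c` in register `d` on a copy of the argument in register `b`. -/
def Cmd.call (c : ℕ → Cmd) (b d : ℕ) : Cmd := .seq (.assign d (.var b)) (c d)

/-- The expression without variables that denotes a given tree. -/
def Val.quote : Val → Expr
  | .nil => .nil
  | .cons v w => .cons v.quote w.quote

theorem Val.eval_quote (v : Val) (s : Store) : v.quote.eval s = v := by
  induction v with
  | nil => rfl
  | cons v w hv hw => rw [Val.quote, Expr.eval, hv, hw]

namespace Computes

variable {c d e : ℕ → Cmd} {f : α → β} {g : α → γ} {T U W : α → ℕ}

theorem call (hc : Computes c f T) {b d : ℕ} {s : Store} {a : α} (h : s b = toVal a) :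
    Evaluates (.call c b d) s d (toVal (f a)) (2 + T a) :=
  (Evaluates.assign (e := .var b) h).seq le_rfl fun s' h' _ => hc d s' a h'

theorem pair (hc : Computes c f T) (hd : Computes d g U) :
    Computes (fun b => .seq (.call c b (b + 1)) (.seq (.call d b (b + 2))
      (.assign b (.cons (.var (b + 1)) (.var (b + 2))))))
      (fun a => (f a, g a)) fun a => 2 + T a + (2 + U a + 4) := fun b s a h =>
  (hc.call h).seq (by omega) fun s₁ h₁ hlt₁ =>
    (hd.call ((hlt₁ b (by omega)).trans h)).seq (by omega) fun s₂ h₂ hlt₂ =>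
      .assign (congrArg₂ Val.cons ((hlt₂ (b + 1) (by omega)).trans h₁) h₂)

theorem cond {q : α → Bool} {f g : α → β} (hc : Computes c q T) (hd : Computes d f U)
    (he : Computes e g W) :
    Computes (fun b => .seq (.call c b (b + 1)) (.cond (.var (b + 1)) (d b) (e b)))
      (fun a => bif q a then f a else g a) fun a => 2 + T a + (2 + (U a + W a)) := fun b s a h =>
  (hc.call h).seq (by omega) fun s₁ h₁ hlt₁ => by
    have hb : s₁ b = toVal a := (hlt₁ b (by omega)).trans h
    change Evaluates _ s₁ b (toVal (bif q a then f a else g a)) _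
    cases hq : q a with
    | true =>
      refine ((hd b s₁ a hb).cond_true ?_).mono ?_
      · rw [Expr.eval, h₁, hq]
        exact Val.noConfusion
      · rw [Expr.cost]
        omega
    | false =>
      refine ((he b s₁ a hb).cond_false ?_).mono ?_
      · rw [Expr.eval, h₁, hq]
        rfl
      · rw [Expr.cost]
        omega

/-- The loop that folds over a list. The body sees the nonempty list `x :: l` as the pair `(x, l)`,
which is represented by the same tree. -/
theorem loop_foldl {step : α → σ → β → σ} {T : α × (β × List β) × σ → ℕ}
    (hc : Computes c (fun p : α × (β × List β) × σ => (p.1, p.2.1.2, step p.1 p.2.2 p.2.1.1)) T)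
    (b : ℕ) (a : α) (K : ℕ) (l : List β) (init : σ) (s : Store) (hs : s b = toVal (a, l, init))
    (hK : ∀ l₁ x l₂, l = l₁ ++ x :: l₂ → T (a, (x, l₂), l₁.foldl (step a) init) ≤ K) :
    Evaluates (.loop (.hd (.tl (.var b))) (c b)) s b
      (toVal (a, ([] : List β), l.foldl (step a) init)) (l.length * (K + 4) + 4) := by
  induction l generalizing init s with
  | nil =>
    rw [List.foldl_nil, ← hs]
    refine (Evaluates.loop_false ?_).mono (by simp only [Expr.cost]; omega)
    rw [Expr.eval, Expr.eval, Expr.eval, hs]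
    rfl
  | cons x l ih =>
    refine (Evaluates.loop_true ?_ (hc b s (a, (x, l), init) hs) fun s' hs' =>
      ih (step a init x) s' hs' fun l₁ y l₂ h => hK (x :: l₁) y l₂ (by rw [h]; rfl)).mono ?_
    · rw [Expr.eval, Expr.eval, Expr.eval, hs]
      exact Val.noConfusion
    · have := hK [] x l rfl
      simp only [List.foldl_nil] at this
      simp only [Expr.cost, List.length_cons, Nat.succ_mul]
      omega

end Computes

end Computes

section PolyTime

variable {α β γ σ : Type} [TreeEncoding α] [TreeEncoding β] [TreeEncoding γ] [TreeEncoding σ]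

/-- Functions computed by a program in polynomial time. The size of the value is required to be
polynomially bounded as well: the running time does not imply this, because subtrees are shared. -/
@[fun_prop]
structure PolyTime (f : α → β) : Prop where
  exists_computes : ∃ (c : ℕ → Cmd) (T : α → ℕ), PolyBounded T ∧ Computes c f T
  polyBounded : PolyBounded fun a => encSize (f a)

@[fun_prop]
theorem PolyBounded.encSize_comp {f : α → β} (hf : PolyTime f) :
    PolyBounded fun a => WhileLang.encSize (f a) := hf.polyBounded

namespace PolyTime

theorem of_expr {f : α → β} (e : ℕ → Expr) (n : ℕ) (hn : ∀ b, (e b).cost ≤ n)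
    (he : ∀ (b : ℕ) (s : Store) (a : α), s b = toVal a → (e b).eval s = toVal (f a))
    (hf : PolyBounded fun a => encSize (f a)) : PolyTime f :=
  ⟨⟨fun b => .assign b (e b), fun _ => n + 1, .const _, fun b s a h =>
    (Evaluates.assign (he b s a h)).mono (Nat.succ_le_succ (hn b))⟩, hf⟩

theorem of_toVal_eq {f : α → β} (h : ∀ a, toVal (f a) = toVal a) : PolyTime f :=
  of_expr .var 1 (fun _ => le_rfl) (fun _ _ a ha => ha.trans (h a).symm)
    (PolyBounded.encSize.mono fun a => (congrArg Val.size (h a)).le)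

@[fun_prop]
theorem id : PolyTime fun a : α => a := of_toVal_eq fun _ => rfl

@[fun_prop]
theorem const (x : β) : PolyTime fun _ : α => x :=
  of_expr (fun _ => (toVal x).quote) (toVal x).quote.cost (fun _ => le_rfl)
    (fun _ s _ _ => Val.eval_quote _ s) (.const _)

@[fun_prop]
theorem comp {g : β → γ} {f : α → β} (hg : PolyTime g) (hf : PolyTime f) :
    PolyTime fun a => g (f a) := by
  obtain ⟨⟨c, T, hT, hc⟩, hsf⟩ := hf
  obtain ⟨⟨d, U, hU, hd⟩, hsg⟩ := hg
  exact ⟨⟨fun b => .seq (c b) (d b), fun a => T a + U (f a), hT.add (hU.comp hsf), fun b s a h =>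
    (hc b s a h).seq le_rfl fun s' h' _ => hd b s' (f a) h'⟩, hsg.comp hsf⟩

@[fun_prop]
theorem fst : PolyTime fun p : α × β => p.1 :=
  of_expr (fun b => .hd (.var b)) 2 (fun _ => le_rfl)
    (fun b s p h => by rw [Expr.eval, Expr.eval, h]; rfl)
    (PolyBounded.encSize.mono fun p => by rw [encSize_mk]; omega)

@[fun_prop]
theorem snd : PolyTime fun p : α × β => p.2 :=
  of_expr (fun b => .tl (.var b)) 2 (fun _ => le_rfl)
    (fun b s p h => by rw [Expr.eval, Expr.eval, h]; rfl)
    (PolyBounded.encSize.mono fun p => by rw [encSize_mk]; omega)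

@[fun_prop]
theorem pair {f : α → β} {g : α → γ} (hf : PolyTime f) (hg : PolyTime g) :
    PolyTime fun a => (f a, g a) := by
  obtain ⟨c, T, hT, hc⟩ := hf.exists_computes
  obtain ⟨d, U, hU, hd⟩ := hg.exists_computes
  exact ⟨⟨_, _, by fun_prop, hc.pair hd⟩, by simp only [encSize_mk]; fun_prop⟩

@[fun_prop]
theorem cond {q : α → Bool} {f g : α → β} (hq : PolyTime q) (hf : PolyTime f) (hg : PolyTime g) :
    PolyTime fun a => bif q a then f a else g a := by
  obtain ⟨c, T, hT, hc⟩ := hq.exists_computes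
  obtain ⟨d, U, hU, hd⟩ := hf.exists_computes
  obtain ⟨e, W, hW, he⟩ := hg.exists_computes
  refine ⟨⟨_, _, by fun_prop, hc.cond hd he⟩, (hf.polyBounded.add hg.polyBounded).mono fun a => ?_⟩
  cases q a <;> simp

theorem list_foldl {l : α → List β} {init : α → σ} {step : α → σ → β → σ} {B : α → ℕ}
    (hl : PolyTime l) (hinit : PolyTime init)
    (hstep : PolyTime fun p : α × σ × β => step p.1 p.2.1 p.2.2) (hB : PolyBounded B)
    (hle : ∀ a l₁, l₁ <+: l a → encSize (l₁.foldl (step a) (init a)) ≤ B a) :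
    PolyTime fun a => (l a).foldl (step a) (init a) := by
  have hstart : PolyTime fun a => (a, l a, init a) := by fun_prop
  have hbody : PolyTime fun p : α × (β × List β) × σ => (p.1, p.2.1.2, step p.1 p.2.2 p.2.1.1) :=
    pair fst (pair (by fun_prop)
      (hstep.comp (f := fun p : α × (β × List β) × σ => (p.1, p.2.2, p.2.1.1)) (by fun_prop)))
  obtain ⟨c, T, ⟨p, hp⟩, hc⟩ := hbody.exists_computes
  let K a := p.eval (encSize a + (encSize (l a) + B a + 1) + 1)
  have hK : PolyBounded K := .polynomial_eval p (by fun_prop)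
  obtain ⟨d, U, hU, hd⟩ := hstart.exists_computes
  refine ⟨⟨fun b => .seq (d b) (.seq (.loop (.hd (.tl (.var b))) (c b))
    (.assign b (.tl (.tl (.var b))))), fun a => U a + ((encSize (l a) * (K a + 4) + 4) + 4),
    by fun_prop, fun b s a h => (hd b s a h).seq le_rfl fun s₁ h₁ _ => ?_⟩,
    hB.mono fun a => hle a _ List.prefix_rfl⟩
  refine ((hc.loop_foldl b a (K a) (l a) (init a) s₁ h₁ fun l₁ x l₂ h => ?_).mono ?_).seq le_rfl
    fun s₂ h₂ _ => .assign (by rw [Expr.eval, Expr.eval, Expr.eval, h₂]; rfl)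
  · refine (hp _).trans (polynomial_eval_mono p ?_)
    have hB := hle a l₁ ⟨_, h.symm⟩
    have hx := encSize_le_of_sublist (h ▸ List.sublist_append_right l₁ (x :: l₂))
    simp only [encSize_mk, encSize_cons] at hx ⊢
    omega
  · exact Nat.add_le_add_right (Nat.mul_le_mul_right _ (length_le_encSize _)) _

@[fun_prop]
theorem list_cons {f : α → β} {l : α → List β} (hf : PolyTime f) (hl : PolyTime l) :
    PolyTime fun a => f a :: l a :=
  (of_toVal_eq (f := fun p : β × List β => p.1 :: p.2) fun _ => rfl).comp (hf.pair hl)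

@[fun_prop]
theorem list_reverse {l : α → List β} (hl : PolyTime l) : PolyTime fun a => (l a).reverse := by
  have hfold (m : List β) : m.foldl (fun s x => x :: s) [] = m.reverse := List.foldl_cons_nil
  simp only [← hfold]
  refine list_foldl (step := fun _ s x => x :: s) hl (const []) (by fun_prop) hl.polyBounded
    fun a l₁ h => ?_
  rw [hfold, encSize_reverse]
  exact encSize_le_of_sublist h.sublist

theorem list_rec {l : α → List β} {F : α → List β → σ} {step : α → β → List β → σ → σ} {B : α → ℕ}
    (hl : PolyTime l) (hnil : PolyTime fun a => F a [])
    (hcons : ∀ a x m, F a (x :: m) = step a x m (F a m))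
    (hstep : PolyTime fun p : α × β × List β × σ => step p.1 p.2.1 p.2.2.1 p.2.2.2)
    (hB : PolyBounded B) (hle : ∀ a l₁, l₁ <:+ l a → encSize (F a l₁) ≤ B a) :
    PolyTime fun a => F a (l a) := by
  have hfold (a : α) (m : List β) :
      m.reverse.foldl (fun s x => (x :: s.1, step a x s.1 s.2)) ([], F a []) = (m, F a m) := by
    rw [List.foldl_reverse]
    induction m with
    | nil => rfl
    | cons x m ih => rw [List.foldr_cons, ih, hcons]
  have hpair : PolyTime fun a => (l a, F a (l a)) := by
    refine (funext fun a => hfold a (l a)) ▸ list_foldl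
      (step := fun a s x => (x :: s.1, step a x s.1 s.2))
      (B := fun a => encSize (l a) + B a + 1) hl.list_reverse (by fun_prop) ?_
      (by fun_prop) fun a l₁ h => ?_
    · exact pair (by fun_prop) (hstep.comp
        (f := fun p : α × (List β × σ) × β => (p.1, p.2.2, p.2.1.1, p.2.1.2)) (by fun_prop))
    · have hsuf : l₁.reverse <:+ l a := by simpa using List.reverse_suffix.2 h
      have h₁ := encSize_le_of_sublist hsuf.sublist
      have h₂ := hle a _ hsuf
      rw [← l₁.reverse_reverse, hfold, encSize_mk]
      omega
  exact snd.comp hpair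

theorem nat_rec {n : α → ℕ} {F : α → ℕ → σ} {step : α → ℕ → σ → σ} {B : α → ℕ} (hn : PolyTime n)
    (hzero : PolyTime fun a => F a 0) (hsucc : ∀ a k, F a (k + 1) = step a k (F a k))
    (hstep : PolyTime fun p : α × ℕ × σ => step p.1 p.2.1 p.2.2) (hB : PolyBounded B)
    (hle : ∀ a, ∀ k ≤ n a, encSize (F a k) ≤ B a) : PolyTime fun a => F a (n a) := by
  have hunits : PolyTime fun k : ℕ => List.replicate k () := of_toVal_eq fun k => by
    simp only [toVal, List.map_replicate, Val.ofNatUnary]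
  have hcount : PolyTime fun l : List Unit => l.length := of_toVal_eq fun l => by
    simp only [toVal, List.map_const', Val.ofNatUnary]
  have := list_rec (F := fun a l => F a l.length) (step := fun a _ m s => step a m.length s)
    (hunits.comp hn) hzero (fun a _ m => hsucc a m.length) (hstep.comp
      (f := fun p : α × Unit × List Unit × σ => (p.1, p.2.2.1.length, p.2.2.2)) (by fun_prop)) hB
    fun a l₁ h => hle a _ (by simpa using h.length_le)
  simpa only [List.length_replicate] using this

theorem iterate {n : α → ℕ} {f : α → σ → σ} {x : α → σ} {G : α → ℕ} (hn : PolyTime n)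
    (hf : PolyTime fun p : α × σ => f p.1 p.2) (hx : PolyTime x) (hG : PolyBounded G)
    (hle : ∀ a y, encSize (f a y) ≤ encSize y + G a) : PolyTime fun a => (f a)^[n a] (x a) := by
  refine nat_rec (F := fun a k => (f a)^[k] (x a)) (step := fun a _ s => f a s)
    (B := fun a => encSize (x a) + encSize (n a) * G a) hn hx
    (fun _ _ => Function.iterate_succ_apply' _ _ _)
    (hf.comp (f := fun p : α × ℕ × σ => (p.1, p.2.2)) (by fun_prop)) (by fun_prop) fun a k hk => ?_
  have hgrow : encSize ((f a)^[k] (x a)) ≤ encSize (x a) + k * G a := by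
    clear hk
    induction k with
    | zero => simp
    | succ k ih =>
      rw [Function.iterate_succ_apply', Nat.succ_mul]
      have := hle a ((f a)^[k] (x a))
      omega
  refine hgrow.trans (Nat.add_le_add_left (Nat.mul_le_mul_right _ (hk.trans ?_)) _)
  rw [encSize_nat]
  omega

@[fun_prop]
theorem list_append {l m : α → List β} (hl : PolyTime l) (hm : PolyTime m) :
    PolyTime fun a => l a ++ m a :=
  list_rec (F := fun a l => l ++ m a) (step := fun _ x _ s => x :: s)
    (B := fun a => encSize (l a) + encSize (m a)) hl hm (fun _ _ _ => rfl) (by fun_prop)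
    (by fun_prop) fun a l₁ h => by
      have := encSize_append l₁ (m a)
      have := encSize_le_of_sublist h.sublist
      omega

@[fun_prop]
theorem list_headD {l : α → List β} {d : α → β} (hl : PolyTime l) (hd : PolyTime d) :
    PolyTime fun a => (l a).headD (d a) :=
  list_rec (F := fun a l => l.headD (d a)) (step := fun _ x _ _ => x)
    (B := fun a => encSize (l a) + encSize (d a)) hl hd (fun _ _ _ => rfl) (by fun_prop)
    (by fun_prop) fun a l₁ h => by
      cases l₁ with
      | nil => exact Nat.le_add_left _ _
      | cons x m => exact le_add_right (encSize_le_of_mem (h.subset List.mem_cons_self))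

@[fun_prop]
theorem list_tail {l : α → List β} (hl : PolyTime l) : PolyTime fun a => (l a).tail :=
  list_rec (F := fun _ l => l.tail) (step := fun _ _ m _ => m) hl (const [])
    (fun _ _ _ => rfl) (by fun_prop) hl.polyBounded
    fun _ l₁ h => encSize_le_of_sublist (l₁.tail_sublist.trans h.sublist)

@[fun_prop]
theorem list_map {l : α → List β} {f : α → β → γ} (hl : PolyTime l)
    (hf : PolyTime fun p : α × β => f p.1 p.2) : PolyTime fun a => (l a).map (f a) := by
  obtain ⟨p, hp⟩ := hf.polyBounded
  refine list_rec (F := fun a l => l.map (f a)) (step := fun a x _ s => f a x :: s)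
    (B := fun a => encSize (l a) * (p.eval (encSize a + encSize (l a) + 1) + 1) + 1) hl (const [])
    (fun _ _ _ => rfl) (list_cons (hf.comp (f := fun p : α × β × List β × List γ => (p.1, p.2.1))
      (by fun_prop)) (by fun_prop)) ?_ fun a l₁ h => ?_
  · have := PolyBounded.polynomial_eval (T := fun a => encSize a + encSize (l a) + 1) p
      (by fun_prop)
    fun_prop
  · refine encSize_le_of_forall_mem_le ?_ (List.forall_mem_map.2 fun x hx => ?_)
    · rw [List.length_map]
      exact h.length_le.trans (length_le_encSize _)
    · refine (hp (a, x)).trans (polynomial_eval_mono p ?_)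
      have := encSize_le_of_mem (h.subset hx)
      rw [encSize_mk]
      omega

@[fun_prop]
theorem list_flatten {l : α → List (List β)} (hl : PolyTime l) : PolyTime fun a => (l a).flatten :=
  list_rec (F := fun _ l => l.flatten) (step := fun _ x _ s => x ++ s) hl (const [])
    (fun _ _ _ => List.flatten_cons) (by fun_prop) hl.polyBounded
    fun a l₁ h => (encSize_flatten_le l₁).trans (encSize_le_of_sublist h.sublist)

@[fun_prop]
theorem list_flatMap {l : α → List β} {f : α → β → List γ} (hl : PolyTime l)
    (hf : PolyTime fun p : α × β => f p.1 p.2) : PolyTime fun a => (l a).flatMap (f a) := by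
  simp only [List.flatMap_def]
  fun_prop

@[fun_prop]
theorem bool_and {f g : α → Bool} (hf : PolyTime f) (hg : PolyTime g) :
    PolyTime fun a => f a && g a := by
  simp only [← Bool.cond_false_right]
  fun_prop

@[fun_prop]
theorem bool_or {f g : α → Bool} (hf : PolyTime f) (hg : PolyTime g) :
    PolyTime fun a => f a || g a := by
  simp only [← Bool.cond_true_left]
  fun_prop

@[fun_prop]
theorem bool_not {f : α → Bool} (hf : PolyTime f) : PolyTime fun a => !f a := by
  have (a : α) : (!f a) = bif f a then false else true := by cases f a <;> rfl
  simp only [this]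
  fun_prop

@[fun_prop]
theorem bool_beq {f g : α → Bool} (hf : PolyTime f) (hg : PolyTime g) :
    PolyTime fun a => f a == g a := by
  have (a : α) : (f a == g a) = bif f a then g a else !g a := by
    cases f a <;> simp
  simp only [this]
  fun_prop

@[fun_prop]
theorem list_filter {l : α → List β} {q : α → β → Bool} (hl : PolyTime l)
    (hq : PolyTime fun p : α × β => q p.1 p.2) : PolyTime fun a => (l a).filter (q a) :=
  list_rec (F := fun a l => l.filter (q a)) (step := fun a x _ s => bif q a x then x :: s else s)
    hl (const []) (fun a x m => by rw [List.filter_cons, Bool.cond_eq_ite])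
    (cond (hq.comp (f := fun p : α × β × List β × List β => (p.1, p.2.1)) (by fun_prop))
      (by fun_prop) (by fun_prop)) hl.polyBounded
    fun a l₁ h => encSize_le_of_sublist (List.filter_sublist.trans h.sublist)

@[fun_prop]
theorem list_any {l : α → List β} {q : α → β → Bool} (hl : PolyTime l)
    (hq : PolyTime fun p : α × β => q p.1 p.2) : PolyTime fun a => (l a).any (q a) :=
  list_rec (F := fun a l => l.any (q a)) (step := fun a x _ s => q a x || s) hl (const false)
    (fun _ _ _ => List.any_cons)
    (bool_or (hq.comp (f := fun p : α × β × List β × Bool => (p.1, p.2.1)) (by fun_prop))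
      (by fun_prop)) (.const 3) fun _ _ _ => encSize_bool_le _

@[fun_prop]
theorem list_all {l : α → List β} {q : α → β → Bool} (hl : PolyTime l)
    (hq : PolyTime fun p : α × β => q p.1 p.2) : PolyTime fun a => (l a).all (q a) := by
  simp only [List.all_eq_not_any_not]
  fun_prop

theorem nat_succ {n : α → ℕ} (hn : PolyTime n) : PolyTime fun a => n a + 1 :=
  (of_toVal_eq (f := fun p : Unit × ℕ => p.2 + 1) fun _ => rfl).comp ((const ()).pair hn)

theorem nat_pred {n : α → ℕ} (hn : PolyTime n) : PolyTime fun a => n a - 1 :=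
  nat_rec (F := fun _ k => k - 1) (step := fun _ k _ => k) hn (const 0) (fun _ _ => rfl)
    (by fun_prop) hn.polyBounded fun a k hk => by
      rw [encSize_nat, encSize_nat]
      omega

theorem nat_beq_zero {n : α → ℕ} (hn : PolyTime n) : PolyTime fun a => n a == 0 :=
  nat_rec (F := fun _ k => k == 0) (step := fun _ _ _ => false) hn (const true) (fun _ _ => rfl)
    (by fun_prop) (.const 3) fun _ _ _ => encSize_bool_le _

@[fun_prop]
theorem nat_add {m n : α → ℕ} (hm : PolyTime m) (hn : PolyTime n) :
    PolyTime fun a => m a + n a :=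
  nat_rec (F := fun a k => m a + k) (step := fun _ _ s => s + 1)
    (B := fun a => encSize (m a) + encSize (n a)) hn hm (fun _ _ => rfl)
    (nat_succ (by fun_prop)) (by fun_prop) fun a k hk => by
      simp only [encSize_nat]
      omega

@[fun_prop]
theorem nat_mul {m n : α → ℕ} (hm : PolyTime m) (hn : PolyTime n) :
    PolyTime fun a => m a * n a :=
  nat_rec (F := fun a k => m a * k) (step := fun a _ s => s + m a)
    (B := fun a => encSize (m a) * encSize (n a)) hn (const 0) (fun _ _ => rfl)
    (by fun_prop) (by fun_prop) fun a k hk => by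
      have := Nat.mul_le_mul_left (m a) hk
      simp only [encSize_nat]
      nlinarith

@[fun_prop]
theorem nat_sub {m n : α → ℕ} (hm : PolyTime m) (hn : PolyTime n) :
    PolyTime fun a => m a - n a :=
  nat_rec (F := fun a k => m a - k) (step := fun _ _ s => s - 1) hn hm (fun _ _ => rfl)
    (nat_pred (by fun_prop)) hm.polyBounded fun a k _ => by
      rw [encSize_nat, encSize_nat]
      omega

@[fun_prop]
theorem nat_decide_le {m n : α → ℕ} (hm : PolyTime m) (hn : PolyTime n) :
    PolyTime fun a => decide (m a ≤ n a) := by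
  have (a : α) : decide (m a ≤ n a) = (m a - n a == 0) := by grind
  simp only [this]
  exact nat_beq_zero (hm.nat_sub hn)

@[fun_prop]
theorem nat_beq {m n : α → ℕ} (hm : PolyTime m) (hn : PolyTime n) :
    PolyTime fun a => m a == n a := by
  have (a : α) : (m a == n a) = (decide (m a ≤ n a) && decide (n a ≤ m a)) := by grind
  simp only [this]
  fun_prop

@[fun_prop]
theorem nat_min {m n : α → ℕ} (hm : PolyTime m) (hn : PolyTime n) :
    PolyTime fun a => min (m a) (n a) := by
  simp only [min_def, ← Bool.cond_decide]
  fun_prop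

@[fun_prop]
theorem prod_beq [BEq β] [BEq γ] {f g : α → β × γ}
    (hβ : PolyTime fun p : β × β => p.1 == p.2) (hγ : PolyTime fun p : γ × γ => p.1 == p.2)
    (hf : PolyTime f) (hg : PolyTime g) : PolyTime fun a => f a == g a :=
  (hβ.comp (f := fun a => ((f a).1, (g a).1)) (by fun_prop)).bool_and
    (hγ.comp (f := fun a => ((f a).2, (g a).2)) (by fun_prop))

@[fun_prop]
theorem list_contains [BEq β] {l : α → List β} {f : α → β}
    (hβ : PolyTime fun p : β × β => p.1 == p.2) (hl : PolyTime l) (hf : PolyTime f) :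
    PolyTime fun a => (l a).contains (f a) := by
  simp only [List.contains_eq_any_beq]
  exact list_any hl (hβ.comp (f := fun p : α × β => (f p.1, p.2)) (by fun_prop))

@[fun_prop]
theorem list_length {l : α → List β} (hl : PolyTime l) : PolyTime fun a => (l a).length :=
  list_rec (F := fun _ l => l.length) (step := fun _ _ _ k => k + 1)
    (B := fun a => 2 * encSize (l a) + 1) hl (const 0) (fun _ _ _ => rfl) (by fun_prop)
    (by fun_prop) fun a l₁ h => by
      have := h.length_le.trans (length_le_encSize _)
      rw [encSize_nat]
      omega

@[fun_prop]
theorem list_sum {l : α → List ℕ} (hl : PolyTime l) : PolyTime fun a => (l a).sum :=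
  list_rec (F := fun _ l => l.sum) (step := fun _ x _ s => x + s) hl (const 0)
    (fun _ _ _ => List.sum_cons) (by fun_prop) hl.polyBounded fun a l₁ h => by
      refine le_trans ?_ (encSize_le_of_sublist h.sublist)
      clear h
      induction l₁ with
      | nil => rfl
      | cons x m ih =>
        simp only [encSize_cons, List.sum_cons, encSize_nat] at ih ⊢
        omega

@[fun_prop]
theorem list_range {n : α → ℕ} (hn : PolyTime n) : PolyTime fun a => List.range (n a) :=
  nat_rec (F := fun _ k => List.range k) (step := fun _ k s => s ++ [k])
    (B := fun a => encSize (n a) * (encSize (n a) + 1) + 1) hn (const [])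
    (fun _ _ => List.range_succ) (by fun_prop) (by fun_prop) fun a k hk => by
      refine encSize_le_of_forall_mem_le ?_ fun x hx => ?_
      · rw [List.length_range, encSize_nat]
        omega
      · have := List.mem_range.1 hx
        rw [encSize_nat, encSize_nat]
        omega

@[fun_prop]
theorem list_drop {l : α → List β} {n : α → ℕ} (hl : PolyTime l) (hn : PolyTime n) :
    PolyTime fun a => (l a).drop (n a) :=
  nat_rec (F := fun a k => (l a).drop k) (step := fun _ _ s => s.tail) hn hl
    (fun _ _ => List.tail_drop.symm) (by fun_prop) hl.polyBounded
    fun _ _ _ => encSize_le_of_sublist (List.drop_sublist _ _)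

@[fun_prop]
theorem list_take {l : α → List β} {n : α → ℕ} (hl : PolyTime l) (hn : PolyTime n) :
    PolyTime fun a => (l a).take (n a) := by
  have (a : α) : (l a).take (n a) = ((l a).reverse.drop ((l a).length - n a)).reverse := by
    rw [List.drop_reverse, List.reverse_reverse, List.take_eq_take_iff]
    omega
  simp only [this]
  fun_prop

@[fun_prop]
theorem list_getD {l : α → List β} {n : α → ℕ} {d : α → β} (hl : PolyTime l) (hn : PolyTime n)
    (hd : PolyTime d) : PolyTime fun a => (l a).getD (n a) (d a) := by
  simp only [List.getD_eq_getElem?_getD, ← List.head?_drop, ← List.headD_eq_head?_getD]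
  fun_prop

@[fun_prop]
theorem list_product {l : α → List β} {m : α → List γ} (hl : PolyTime l) (hm : PolyTime m) :
    PolyTime fun a => l a ×ˢ m a := by
  change PolyTime fun a => (l a).flatMap fun x => (m a).map (Prod.mk x)
  fun_prop

theorem polyTimeSolvableOn {ι : Type} {f : α → Bool} (hf : PolyTime f) {enc : ι → Val}
    {dom yes : ι → Prop} (input : ι → α) (henc : ∀ i, toVal (input i) = enc i)
    (hyes : ∀ i, dom i → (f (input i) = true ↔ yes i)) : PolyTimeSolvableOn enc dom yes := by
  obtain ⟨⟨c, T, ⟨p, hp⟩, hc⟩, -⟩ := hf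
  refine ⟨c 0, p, fun i hi => ?_⟩
  obtain ⟨s, t, hrun, hs, -, ht⟩ := hc 0 (initStore (enc i)) (input i) (henc i).symm
  refine ⟨s, t, hrun, ht.trans (henc i ▸ hp (input i)), ?_⟩
  rw [hs, ← hyes i hi]
  cases f (input i) <;> simp [toVal, Val.ofBool]

end PolyTime

end PolyTime

end WhileLang

namespace WhileLang

section Minimum

/-- The least element of a list of numbers and `B`. -/
def minimumWith (B : ℕ) (l : List ℕ) : ℕ := l.foldr min B

theorem minimumWith_le_default (B : ℕ) (l : List ℕ) : minimumWith B l ≤ B := by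
  induction l with
  | nil => exact le_rfl
  | cons x l ih => exact (min_le_right _ _).trans ih

theorem minimumWith_le_of_mem {B x : ℕ} {l : List ℕ} (h : x ∈ l) : minimumWith B l ≤ x := by
  induction h with
  | head l => exact min_le_left _ _
  | tail y _ ih => exact (min_le_right _ _).trans ih

theorem minimumWith_mem_of_lt {B : ℕ} {l : List ℕ} (h : minimumWith B l < B) :
    minimumWith B l ∈ l := by
  induction l with
  | nil => exact absurd h (lt_irrefl _)
  | cons x l ih =>
    change min x (minimumWith B l) < B at h
    change min x (minimumWith B l) ∈ x :: l
    grind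

@[fun_prop]
theorem polyTime_minimumWith {α : Type} [TreeEncoding α] {B : α → ℕ} {l : α → List ℕ}
    (hB : PolyTime B) (hl : PolyTime l) : PolyTime fun a => minimumWith (B a) (l a) :=
  .list_rec (F := fun a l => minimumWith (B a) l) (step := fun _ x _ s => min x s) hl hB
    (fun _ _ _ => rfl) (by fun_prop) hB.polyBounded fun a l₁ _ => by
      have := minimumWith_le_default (B a) l₁
      rw [encSize_nat, encSize_nat]
      omega

end Minimum

section Partition

variable {β : Type} {w : List β → ℕ} {B : ℕ}

/-- The table of the dynamic program for `partitionCost`: its entry `i` is the cost of the suffix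
that starts at position `i`. -/
def partitionCosts (w : List β → ℕ) (B : ℕ) : List β → List ℕ
  | [] => [0]
  | x :: l => minimumWith B ((List.range (l.length + 1)).map fun i =>
      w ((x :: l).take (i + 1)) + (partitionCosts w B l).getD i B) :: partitionCosts w B l

/-- The least total weight, capped at `B`, of a partition of a list into nonempty segments. -/
def partitionCost (w : List β → ℕ) (B : ℕ) (l : List β) : ℕ := (partitionCosts w B l).headD B

theorem length_partitionCosts (l : List β) : (partitionCosts w B l).length = l.length + 1 := by
  induction l with
  | nil => rfl
  | cons x l ih => rw [partitionCosts, List.length_cons, ih, List.length_cons]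

theorem le_of_mem_partitionCosts {l : List β} {n : ℕ} (h : n ∈ partitionCosts w B l) : n ≤ B := by
  induction l with
  | nil => exact (List.mem_singleton.1 h).trans_le (Nat.zero_le B)
  | cons x l ih =>
    rcases List.mem_cons.1 h with rfl | h
    · exact minimumWith_le_default _ _
    · exact ih h

theorem getD_partitionCosts {l : List β} {i : ℕ} (hi : i ≤ l.length) :
    (partitionCosts w B l).getD i B = partitionCost w B (l.drop i) := by
  induction l generalizing i with
  | nil => obtain rfl := Nat.le_zero.1 hi; rfl
  | cons x l ih =>
    cases i with
    | zero => rfl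
    | succ i => exact ih (Nat.le_of_succ_le_succ hi)

theorem partitionCost_cons (x : β) (l : List β) :
    partitionCost w B (x :: l) = minimumWith B ((List.range (l.length + 1)).map fun i =>
      w ((x :: l).take (i + 1)) + partitionCost w B (l.drop i)) := by
  rw [partitionCost, partitionCosts, List.headD_cons]
  congr 1
  refine List.map_congr_left fun i hi => ?_
  rw [getD_partitionCosts (Nat.le_of_lt_succ (List.mem_range.1 hi))]

theorem partitionCost_append_le {s : List β} (hs : s ≠ []) (l : List β) :
    partitionCost w B (s ++ l) ≤ w s + partitionCost w B l := by
  obtain ⟨x, s, rfl⟩ := List.exists_cons_of_ne_nil hs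
  rw [List.cons_append, partitionCost_cons]
  refine minimumWith_le_of_mem (List.mem_map.2 ⟨s.length, by simp, ?_⟩)
  rw [List.drop_left, List.take_succ_cons, List.take_left]

theorem exists_append_of_partitionCost_lt {l : List β} (hl : l ≠ [])
    (h : partitionCost w B l < B) :
    ∃ s m, s ≠ [] ∧ s ++ m = l ∧ w s + partitionCost w B m = partitionCost w B l := by
  obtain ⟨x, l, rfl⟩ := List.exists_cons_of_ne_nil hl
  rw [partitionCost_cons] at h ⊢
  obtain ⟨i, -, hi⟩ := List.mem_map.1 (minimumWith_mem_of_lt h)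
  exact ⟨_, _, List.cons_ne_nil x (l.take i), congrArg _ (List.take_append_drop i l), hi⟩

theorem partitionCost_flatten_le {P : List (List β)} (hP : ∀ s ∈ P, s ≠ []) :
    partitionCost w B P.flatten ≤ (P.map w).sum := by
  induction P with
  | nil => exact Nat.zero_le _
  | cons s P ih =>
    rw [List.flatten_cons, List.map_cons, List.sum_cons]
    exact (partitionCost_append_le (hP s List.mem_cons_self) _).trans
      (Nat.add_le_add_left (ih fun t ht => hP t (List.mem_cons_of_mem _ ht)) _)

theorem exists_partition_of_partitionCost_lt {l : List β} (h : partitionCost w B l < B) :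
    ∃ P : List (List β), P.flatten = l ∧ (∀ s ∈ P, s ≠ []) ∧
      (P.map w).sum = partitionCost w B l := by
  induction hn : l.length using Nat.strong_induction_on generalizing l with
  | _ n ih =>
    rcases eq_or_ne l [] with rfl | hl
    · exact ⟨[], rfl, by simp, rfl⟩
    obtain ⟨s, m, hs, rfl, hcost⟩ := exists_append_of_partitionCost_lt hl h
    have hlen : m.length < n := by
      rw [← hn, List.length_append]
      exact Nat.lt_add_of_pos_left (List.length_pos_iff.2 hs)
    obtain ⟨P, rfl, hne, hsum⟩ := ih _ hlen (by omega) rfl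
    exact ⟨s :: P, rfl, List.forall_mem_cons.2 ⟨hs, hne⟩, by rw [← hcost, ← hsum]; rfl⟩

@[fun_prop]
theorem polyTime_partitionCost {α : Type} [TreeEncoding α] [TreeEncoding β] {w : α → List β → ℕ}
    {B : α → ℕ} {l : α → List β} (hw : PolyTime fun p : α × List β => w p.1 p.2) (hB : PolyTime B)
    (hl : PolyTime l) : PolyTime fun a => partitionCost (w a) (B a) (l a) := by
  have hstep : PolyTime fun p : α × β × List β × List ℕ =>
      minimumWith (B p.1) ((List.range (p.2.2.1.length + 1)).map fun i =>
        w p.1 ((p.2.1 :: p.2.2.1).take (i + 1)) + p.2.2.2.getD i (B p.1)) :: p.2.2.2 := by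
    have := hw.comp (f := fun p : (α × β × List β × List ℕ) × ℕ =>
      (p.1.1, (p.1.2.1 :: p.1.2.2.1).take (p.2 + 1))) (by fun_prop)
    fun_prop
  refine .list_headD (.list_rec (F := fun a l => partitionCosts (w a) (B a) l)
    (step := fun a x l s => minimumWith (B a) ((List.range (l.length + 1)).map fun i =>
      w a ((x :: l).take (i + 1)) + s.getD i (B a)) :: s)
    (B := fun a => (encSize (l a) + 1) * (encSize (B a) + 1) + 1) hl (.const [0])
    (fun _ _ _ => rfl) hstep (by fun_prop) fun a l₁ h => ?_) hB
  refine encSize_le_of_forall_mem_le ?_ fun n hn => ?_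
  · rw [length_partitionCosts]
    exact Nat.succ_le_succ (h.length_le.trans (length_le_encSize _))
  · have := le_of_mem_partitionCosts hn
    rw [encSize_nat, encSize_nat]
    omega

end Partition

end WhileLang

namespace SteinerForest

open WhileLang

section Algorithm

variable {α : Type} [TreeEncoding α] {M : α → List (List Bool)} {S R : α → List (ℕ × ℕ)}
  {c i j v n : α → ℕ} {L s : α → List ℕ}

/-- The adjacency relation given by an adjacency matrix; it is `false` out of range. -/
def adjEntry (M : List (List Bool)) (i j : ℕ) : Bool := (M.getD i []).getD j false

@[fun_prop]
theorem polyTime_adjEntry (hM : PolyTime M) (hi : PolyTime i) (hj : PolyTime j) :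
    PolyTime fun a => adjEntry (M a) (i a) (j a) := by
  unfold adjEntry
  fun_prop

/-- The adjacency relation of the graph after deletion of the vertex `c` and of the edges in `R`,
which may be listed in either direction. -/
def residualEntry (M : List (List Bool)) (R : List (ℕ × ℕ)) (c i j : ℕ) : Bool :=
  adjEntry M i j && !(i == c) && !(j == c) && !R.contains (i, j) && !R.contains (j, i)

@[fun_prop]
theorem polyTime_residualEntry (hM : PolyTime M) (hR : PolyTime R) (hc : PolyTime c)
    (hi : PolyTime i) (hj : PolyTime j) :
    PolyTime fun a => residualEntry (M a) (R a) (c a) (i a) (j a) := by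
  unfold residualEntry
  fun_prop

/-- One step of the exploration of a path in the residual graph: the neighbours of the head of `L`
that are not yet in `L` are put in front. For `L = []` nothing happens, since the vertex `c` is
isolated in the residual graph. -/
def extend (M : List (List Bool)) (R : List (ℕ × ℕ)) (c : ℕ) (L : List ℕ) : List ℕ :=
  ((List.range M.length).filter fun w => residualEntry M R c (L.headD c) w && !L.contains w) ++ L

@[fun_prop]
theorem polyTime_extend (hM : PolyTime M) (hR : PolyTime R) (hc : PolyTime c) (hL : PolyTime L) :
    PolyTime fun a => extend (M a) (R a) (c a) (L a) := by
  unfold extend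
  fun_prop

/-- The lists obtained by exploring the residual graph from one vertex or from an ordered pair of
vertices. -/
def explorations (M : List (List Bool)) (R : List (ℕ × ℕ)) (c : ℕ) : List (List ℕ) :=
  (List.range M.length).flatMap fun u =>
    [u] :: (List.range M.length).map fun v => (extend M R c)^[M.length] [v, u]

@[fun_prop]
theorem polyTime_explorations (hM : PolyTime M) (hR : PolyTime R) (hc : PolyTime c) :
    PolyTime fun a => explorations (M a) (R a) (c a) := by
  have hiter : PolyTime fun p : (α × ℕ) × ℕ =>
      (extend (M p.1.1) (R p.1.1) (c p.1.1))^[(M p.1.1).length] [p.2, p.1.2] := by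
    refine PolyTime.iterate (f := fun p : (α × ℕ) × ℕ => extend (M p.1.1) (R p.1.1) (c p.1.1))
      (G := fun p => encSize (List.range (M p.1.1).length)) (by fun_prop) (by fun_prop)
      (by fun_prop) (by fun_prop) fun p L => ?_
    have hsize := encSize_append ((List.range (M p.1.1).length).filter fun w =>
      residualEntry (M p.1.1) (R p.1.1) (c p.1.1) (L.headD (c p.1.1)) w && !L.contains w) L
    have hle := encSize_le_of_sublist (List.filter_sublist (l := List.range (M p.1.1).length)
      (p := fun w => residualEntry (M p.1.1) (R p.1.1) (c p.1.1) (L.headD (c p.1.1)) w &&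
        !L.contains w))
    unfold extend
    omega
  unfold explorations
  fun_prop

/-- The test whether `L` runs along a path through all vertices of a component of the residual
graph. -/
def isTraversal (M : List (List Bool)) (R : List (ℕ × ℕ)) (c : ℕ) (L : List ℕ) : Bool :=
  (List.range (L.length - 1)).all
      (fun i => residualEntry M R c (L.getD i 0) (L.getD (i + 1) 0)) &&
    L.all fun u => (List.range M.length).all fun w => !residualEntry M R c u w || L.contains w

@[fun_prop]
theorem polyTime_isTraversal (hM : PolyTime M) (hR : PolyTime R) (hc : PolyTime c)
    (hL : PolyTime L) : PolyTime fun a => isTraversal (M a) (R a) (c a) (L a) := by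
  unfold isTraversal
  fun_prop

/-- The traversals of the component of `v` that are found by exploration. -/
def traversals (M : List (List Bool)) (R : List (ℕ × ℕ)) (c v : ℕ) : List (List ℕ) :=
  (explorations M R c).filter fun L => isTraversal M R c L && L.contains v

@[fun_prop]
theorem polyTime_traversals (hM : PolyTime M) (hR : PolyTime R) (hc : PolyTime c)
    (hv : PolyTime v) : PolyTime fun a => traversals (M a) (R a) (c a) (v a) := by
  unfold traversals
  fun_prop

/-- The test whether every terminal pair in `S` lies inside or outside of `s`. -/
def separatesNone (S : List (ℕ × ℕ)) (s : List ℕ) : Bool :=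
  S.all fun p => s.contains p.1 == s.contains p.2

@[fun_prop]
theorem polyTime_separatesNone (hS : PolyTime S) (hs : PolyTime s) :
    PolyTime fun a => separatesNone (S a) (s a) := by
  unfold separatesNone
  fun_prop

/-- A cost that exceeds the number of edges of a graph with `M.length` vertices. -/
def infiniteCost (M : List (List Bool)) : ℕ := M.length * M.length + 1

@[fun_prop]
theorem polyTime_infiniteCost (hM : PolyTime M) : PolyTime fun a => infiniteCost (M a) := by
  unfold infiniteCost
  fun_prop

/-- The number of edges spent on a segment `s` of a path: the edges of the path between its
vertices, and one edge to `c` unless `S` separates no vertex of `s` from its partners. -/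
def segmentCost (M : List (List Bool)) (S : List (ℕ × ℕ)) (c : ℕ) (s : List ℕ) : ℕ :=
  bif separatesNone S s then s.length - 1
  else bif s.any (adjEntry M c) then s.length else infiniteCost M

@[fun_prop]
theorem polyTime_segmentCost (hM : PolyTime M) (hS : PolyTime S) (hc : PolyTime c)
    (hs : PolyTime s) : PolyTime fun a => segmentCost (M a) (S a) (c a) (s a) := by
  unfold segmentCost
  fun_prop

/-- The least cost of cutting a traversal of the component of `v` into segments. -/
def componentCost (M : List (List Bool)) (S R : List (ℕ × ℕ)) (c v : ℕ) : ℕ :=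
  minimumWith (infiniteCost M)
    ((traversals M R c v).map (partitionCost (segmentCost M S c) (infiniteCost M)))

@[fun_prop]
theorem polyTime_componentCost (hM : PolyTime M) (hS : PolyTime S) (hR : PolyTime R)
    (hc : PolyTime c) (hv : PolyTime v) :
    PolyTime fun a => componentCost (M a) (S a) (R a) (c a) (v a) := by
  unfold componentCost
  fun_prop

/-- The least vertices of the components of the residual graph without `c`. A vertex whose component
has no traversal is included, and has infinite cost. -/
def roots (M : List (List Bool)) (R : List (ℕ × ℕ)) (c : ℕ) : List ℕ :=
  (List.range M.length).filter fun v =>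
    !(v == c) && (traversals M R c v).all fun L => L.all fun u => decide (v ≤ u)

@[fun_prop]
theorem polyTime_roots (hM : PolyTime M) (hR : PolyTime R) (hc : PolyTime c) :
    PolyTime fun a => roots (M a) (R a) (c a) := by
  unfold roots
  fun_prop

/-- The number of edges of the cheapest Steiner forest that uses no edge in `R` and whose components
without the vertex `c` are segments of traversals. -/
def totalCost (M : List (List Bool)) (S R : List (ℕ × ℕ)) (c : ℕ) : ℕ :=
  ((roots M R c).map (componentCost M S R c)).sum

@[fun_prop]
theorem polyTime_totalCost (hM : PolyTime M) (hS : PolyTime S) (hR : PolyTime R)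
    (hc : PolyTime c) : PolyTime fun a => totalCost (M a) (S a) (R a) (c a) := by
  unfold totalCost
  fun_prop

/-- The lists of at most `r` elements of `l`. -/
def listsUpTo {β : Type} (l : List β) : ℕ → List (List β)
  | 0 => [[]]
  | r + 1 => [] :: l.flatMap fun x => (listsUpTo l r).map fun m => x :: m

theorem mem_listsUpTo {β : Type} {l m : List β} {r : ℕ} :
    m ∈ listsUpTo l r ↔ m.length ≤ r ∧ m ⊆ l := by
  induction r generalizing m with
  | zero => cases m <;> simp [listsUpTo]
  | succ r ih => cases m <;> simp [listsUpTo, ih, and_left_comm]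

@[fun_prop]
theorem polyTime_listsUpTo {β : Type} [TreeEncoding β] {l : α → List β} (hl : PolyTime l) (r : ℕ) :
    PolyTime fun a => listsUpTo (l a) r := by
  induction r with
  | zero => exact .const [[]]
  | succ r ih =>
    have := ih.comp (f := fun p : α × β => p.1) (by fun_prop)
    unfold listsUpTo
    fun_prop

/-- The number with the given binary digits, least significant first, capped at `m`. -/
def cappedValue (m : ℕ) : List Bool → ℕ
  | [] => 0
  | b :: l => min m (2 * cappedValue m l + bif b then 1 else 0)

theorem cappedValue_bits (m k : ℕ) : cappedValue m k.bits = min m k := by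
  induction k using Nat.binaryRec' with
  | zero => simp [cappedValue]
  | bit b k h ih =>
    rw [Nat.bits_append_bit _ _ h, cappedValue, ih, Nat.bit_val]
    cases b <;> simp <;> omega

@[fun_prop]
theorem polyTime_cappedValue {l : α → List Bool} (hn : PolyTime n) (hl : PolyTime l) :
    PolyTime fun a => cappedValue (n a) (l a) :=
  PolyTime.list_rec (F := fun a l => cappedValue (n a) l)
    (step := fun a b _ k => min (n a) (2 * k + bif b then 1 else 0)) hl (.const 0)
    (fun _ _ _ => rfl) (by fun_prop) hn.polyBounded fun a l₁ _ => by
      rw [encSize_nat, encSize_nat]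
      cases l₁ <;> simp [cappedValue]

/-- The decision procedure on an adjacency matrix, a list of terminal pairs and the binary digits of
an edge budget. It tries all sets of at most `r` deleted edges. -/
def solve (r : ℕ) (I : List (List Bool) × List (ℕ × ℕ) × List Bool × Unit) : Bool :=
  (listsUpTo (List.range I.1.length ×ˢ List.range I.1.length) r).any fun R =>
    (List.range (I.1.length + 1)).any fun c =>
      decide (totalCost I.1 I.2.1 R c ≤ cappedValue (I.1.length * I.1.length) I.2.2.1)

theorem polyTime_solve (r : ℕ) : PolyTime (solve r) := by
  unfold solve
  fun_prop

end Algorithm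

end SteinerForest

namespace SteinerForest

open SimpleGraph WhileLang

section Helly

variable {V : Type*} {F : SimpleGraph V} {T : Set V}

theorem exists_isPath_of_reachable_of_mem {r y : V} (h : F.Reachable r y) (hy : y ∈ T) :
    ∃ t ∈ T, ∃ p : F.Walk r t, p.IsPath ∧ ∀ z ∈ p.support, z ∈ T → z = t := by
  classical
  obtain ⟨p, hp⟩ := h.exists_isPath
  obtain ⟨t, ht, htp, hfirst⟩ := p.exists_mem_support_forall_mem_support_imp_eq
    (p.support.toFinset.filter (· ∈ T)) ⟨y, by simpa using hy⟩
  refine ⟨t, (Finset.mem_filter.1 ht).2, p.takeUntil t htp, hp.takeUntil htp, fun z hz hzT => ?_⟩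
  refine hfirst z (Finset.mem_filter.2 ⟨List.mem_toFinset.2 ?_, hzT⟩) hz
  exact p.support_takeUntil_subset_support htp hz

theorem exists_isPath_of_induce_preconnected (hT : (F.induce T).Preconnected) {t y : V}
    (ht : t ∈ T) (hy : y ∈ T) : ∃ q : F.Walk t y, q.IsPath ∧ ∀ z ∈ q.support, z ∈ T := by
  obtain ⟨q, hq⟩ := (hT ⟨t, ht⟩ ⟨y, hy⟩).exists_isPath
  refine ⟨q.map (Embedding.induce (G := F) T).toHom,
    hq.map (Embedding.induce (G := F) T).injective, fun z hz => ?_⟩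
  obtain ⟨x, -, rfl⟩ := List.mem_map.1 (Walk.support_map (Embedding.induce (G := F) T).toHom q ▸ hz)
  exact x.2

/-- The vertex `t` is the gate of `T` from `r`: the paths from `r` to the vertices of `T` start with
`p`, which ends in `t`, and then stay in `T`. -/
def IsGate (T : Set V) {r t : V} (p : F.Walk r t) : Prop :=
  ∀ y ∈ T, ∃ q : F.Walk t y, (∀ z ∈ q.support, z ∈ T) ∧ (p.append q).IsPath

theorem exists_isGate (hT : (F.induce T).Preconnected) {r y : V} (h : F.Reachable r y)
    (hy : y ∈ T) : ∃ (t : V) (p : F.Walk r t), IsGate T p := by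
  obtain ⟨t, ht, p, hp, hfirst⟩ := exists_isPath_of_reachable_of_mem h hy
  refine ⟨t, p, fun y hy => ?_⟩
  obtain ⟨q, hq, hqT⟩ := exists_isPath_of_induce_preconnected hT ht hy
  refine ⟨q, hqT, ?_⟩
  rw [Walk.isPath_def, Walk.support_append, List.nodup_append']
  refine ⟨hp.support_nodup, hq.support_nodup.tail, fun z hz hzq => ?_⟩
  obtain rfl := hfirst z hz (hqT z (List.mem_of_mem_tail hzq))
  have := hq.support_nodup
  rw [← q.cons_tail_support] at this
  exact (List.nodup_cons.1 this).1 hzq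

/-- The unique path from `r` to a common vertex passes first the gate of `T'` and then that of `T`,
and it does not leave `T'` in between. -/
theorem IsGate.mem_of_length_le (hF : F.IsAcyclic) {T' : Set V} {r t t' : V} {p : F.Walk r t}
    {p' : F.Walk r t'} (hp : IsGate T p) (hp' : IsGate T' p') (hle : p'.length ≤ p.length)
    (h : (T ∩ T').Nonempty) : t ∈ T' := by
  obtain ⟨y, hy, hy'⟩ := h
  obtain ⟨q, -, hq⟩ := hp y hy
  obtain ⟨q', hqT', hq'⟩ := hp' y hy'
  have heq : p.append q = p'.append q' :=
    congrArg Subtype.val ((hF.subsingleton_path _ _).elim ⟨_, hq⟩ ⟨_, hq'⟩)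
  have ht : t = q'.getVert (p.length - p'.length) := by
    have := congrArg (Walk.getVert · p.length) heq
    simpa [Walk.getVert_append, hle.not_gt] using this
  rw [ht]
  exact hqT' _ (q'.getVert_mem_support _)

/-- The Helly property of subtrees: the gate that is farthest from a fixed vertex is common. -/
theorem nonempty_sInter_of_isAcyclic (hF : F.IsAcyclic) {𝒯 : Set (Set V)} (hfin : 𝒯.Finite)
    (hne : 𝒯.Nonempty) (hconn : ∀ T ∈ 𝒯, (F.induce T).Preconnected)
    (hmeet : ∀ T ∈ 𝒯, ∀ T' ∈ 𝒯, (T ∩ T').Nonempty) : (⋂₀ 𝒯).Nonempty := by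
  obtain ⟨T₀, hT₀⟩ := hne
  obtain ⟨r, hr, -⟩ := hmeet T₀ hT₀ T₀ hT₀
  have hgate : ∀ T : 𝒯, ∃ (t : V) (p : F.Walk r t), IsGate (T : Set V) p := fun ⟨T, hT⟩ => by
    obtain ⟨y, hy₀, hy⟩ := hmeet T₀ hT₀ T hT
    obtain ⟨p, -⟩ := exists_isPath_of_induce_preconnected (hconn T₀ hT₀) hr hy₀
    exact exists_isGate (hconn T hT) p.reachable hy
  choose t p hp using hgate
  have := hfin.to_subtype
  obtain ⟨T, -, hmax⟩ := Set.exists_max_image Set.univ (fun T => (p T).length) Set.finite_univ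
    ⟨⟨T₀, hT₀⟩, trivial⟩
  exact ⟨t T, fun T' hT' => (hp T).mem_of_length_le hF (hp ⟨T', hT'⟩) (hmax _ trivial)
    (hmeet T T.2 T' hT')⟩

end Helly

section Claws

variable {V : Type*} {G F H : SimpleGraph V} {x y : V} {s t : Finset V}

/-- A claw of `G` with centre `x` and set of leaves `s`, as a subgraph that need not be induced. -/
def IsClaw (G : SimpleGraph V) (x : V) (s : Finset V) : Prop :=
  s.card = 3 ∧ ∀ y ∈ s, G.Adj x y

/-- Any two claws of `G` share a vertex. -/
def ClawsMeet (G : SimpleGraph V) : Prop :=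
  ∀ ⦃x s y t⦄, IsClaw G x s → IsClaw G y t → (insert x (s : Set V) ∩ insert y (t : Set V)).Nonempty

theorem IsClaw.mono (hFG : F ≤ G) (h : IsClaw F x s) : IsClaw G x s :=
  ⟨h.1, fun y hy => hFG (h.2 y hy)⟩

theorem ClawsMeet.mono (hFG : F ≤ G) (hG : ClawsMeet G) : ClawsMeet F :=
  fun _ _ _ _ hs ht => hG (hs.mono hFG) (ht.mono hFG)

theorem eq_of_adj_of_forall_not_isClaw (hH : ∀ x s, ¬ IsClaw H x s) {a b c : V} (ha : H.Adj x a)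
    (hb : H.Adj x b) (hc : H.Adj x c) (hab : a ≠ b) (hac : a ≠ c) : b = c := by
  classical
  by_contra hbc
  refine hH x {a, b, c} ⟨Finset.card_eq_three.2 ⟨a, b, c, hab, hac, hbc, rfl⟩, ?_⟩
  simp only [Finset.mem_insert, Finset.mem_singleton]
  rintro y (rfl | rfl | rfl) <;> assumption

theorem IsClaw.exists_copy (h : IsClaw G x s) :
    ∃ f : Copy claw G, Set.range f ⊆ insert x (s : Set V) := by
  have e : Fin 3 ≃ s := (finCongr h.1.symm).trans s.equivFin.symm
  have hadj (i : Fin 3) : G.Adj x (e i) := h.2 _ (e i).2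
  refine ⟨⟨⟨Sum.elim (fun _ => x) fun i => e i, ?_⟩, ?_⟩, ?_⟩
  · rintro (i | i) (j | j) hij
    · simp at hij
    · exact hadj j
    · exact (hadj i).symm
    · simp at hij
  · exact Function.Injective.sumElim (Function.injective_of_subsingleton _)
      (Subtype.val_injective.comp e.injective) fun _ i => (hadj i).ne
  · rintro _ ⟨i | i, rfl⟩
    · exact Set.mem_insert _ _
    · exact Set.mem_insert_of_mem _ (e i).2

theorem not_free_sum_of_disjoint_range {α β : Type*} {A : SimpleGraph α} {B : SimpleGraph β}
    (f : Copy A G) (g : Copy B G) (h : Disjoint (Set.range f) (Set.range g)) :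
    ¬ (SimpleGraph.sum A B).Free G := by
  refine not_not_intro ⟨⟨⟨Sum.elim f g, ?_⟩, ?_⟩⟩
  · rintro (i | i) (j | j) hij
    · exact f.toHom.map_adj hij
    · exact absurd hij Bool.false_ne_true
    · exact absurd hij Bool.false_ne_true
    · exact g.toHom.map_adj hij
  · exact f.injective.sumElim g.injective fun i j =>
      Set.disjoint_iff_forall_ne.1 h ⟨i, rfl⟩ ⟨j, rfl⟩

theorem clawsMeet_of_twoClaws_free (h : twoClaws.Free G) : ClawsMeet G := by
  intro x s y t hs ht
  obtain ⟨f, hf⟩ := hs.exists_copy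
  obtain ⟨g, hg⟩ := ht.exists_copy
  by_contra hdisj
  rw [← Set.not_disjoint_iff_nonempty_inter, not_not] at hdisj
  exact not_free_sum_of_disjoint_range f g (hdisj.mono hf hg) h

theorem IsClaw.induce_preconnected (h : IsClaw F x s) :
    (F.induce (insert x (s : Set V))).Preconnected := by
  have hx (z : (insert x s : Set V)) :
      (F.induce (insert x (s : Set V))).Reachable ⟨x, Set.mem_insert _ _⟩ z := by
    obtain ⟨z, rfl | hz⟩ := z
    · exact .rfl
    · exact Adj.reachable (h.2 z hz)
  exact fun y z => (hx y).symm.trans (hx z)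

theorem IsClaw.subset_support (h : IsClaw F x s) : insert x (s : Set V) ⊆ F.support := by
  obtain ⟨y, hy⟩ := Finset.card_pos.1 (Nat.zero_lt_succ 2 |>.trans_eq h.1.symm)
  exact Set.insert_subset ⟨y, h.2 y hy⟩ fun z hz => ⟨x, (h.2 z hz).symm⟩

theorem ClawsMeet.exists_common_vertex (hmeet : ClawsMeet F) (hF : F.IsAcyclic)
    (hfin : F.support.Finite) (v : V) :
    ∃ c ∈ insert v F.support, ∀ x s, IsClaw F x s → c ∈ insert x (s : Set V) := by
  by_cases hclaw : ∃ x s, IsClaw F x s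
  · obtain ⟨x, s, hs⟩ := hclaw
    obtain ⟨c, hc⟩ := nonempty_sInter_of_isAcyclic (𝒯 := {T | ∃ x s, IsClaw F x s ∧
      insert x (s : Set V) = T}) hF
      (hfin.finite_subsets.subset (by rintro _ ⟨x, s, h, rfl⟩; exact h.subset_support))
      ⟨_, x, s, hs, rfl⟩ (by rintro _ ⟨x, s, h, rfl⟩; exact h.induce_preconnected)
      (by rintro _ ⟨x, s, h, rfl⟩ _ ⟨y, t, h', rfl⟩; exact hmeet h h')
    exact ⟨c, .inr (hs.subset_support (hc _ ⟨x, s, hs, rfl⟩)), fun x s h => hc _ ⟨x, s, h, rfl⟩⟩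
  · exact ⟨v, Set.mem_insert _ _, fun x s h => absurd ⟨x, s, h⟩ hclaw⟩

/-- Otherwise `c` would have three neighbours outside of the claw. -/
theorem ClawsMeet.mem_of_seven_le_degree [G.LocallyFinite] (hmeet : ClawsMeet G) {c : V}
    (hc : 7 ≤ G.degree c) (h : IsClaw G x s) : c ∈ insert x (s : Set V) := by
  classical
  have hcard : 3 ≤ (G.neighborFinset c \ insert x s).card := by
    have := Finset.le_card_sdiff (insert x s) (G.neighborFinset c)
    have := Finset.card_insert_le x s
    rw [card_neighborFinset_eq_degree] at *
    have := h.1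
    omega
  obtain ⟨t, ht, ht3⟩ := Finset.exists_subset_card_eq hcard
  obtain ⟨z, hz, rfl | hzt⟩ := hmeet h ⟨ht3, fun y hy =>
    (G.mem_neighborFinset c y).1 (Finset.mem_sdiff.1 (ht hy)).1⟩
  · exact hz
  · exact absurd (by exact_mod_cast hz) (Finset.mem_sdiff.1 (ht hzt)).2

open Classical in
theorem ClawsMeet.exists_finset_centers [G.LocallyFinite] (hmeet : ClawsMeet G) {d : ℕ}
    (hdeg : ∀ v, G.degree v ≤ d) :
    ∃ B : Finset V, B.card ≤ 4 * (d + 1) ∧ ∀ x s, IsClaw G x s → x ∈ B := by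
  by_cases hclaw : ∃ x s, IsClaw G x s
  · obtain ⟨x, s, hs⟩ := hclaw
    refine ⟨(insert x s).biUnion fun v => insert v (G.neighborFinset v), ?_, fun y t ht => ?_⟩
    · have h4 : (insert x s).card ≤ 4 := (Finset.card_insert_le x s).trans_eq (by rw [hs.1])
      refine (Finset.card_biUnion_le_card_mul _ _ (d + 1) fun v _ => ?_).trans
        (Nat.mul_le_mul_right _ h4)
      exact (Finset.card_insert_le _ _).trans (Nat.succ_le_succ (hdeg v))
    · obtain ⟨z, hz, hzt⟩ := hmeet hs ht
      refine Finset.mem_biUnion.2 ⟨z, by exact_mod_cast hz, Finset.mem_insert.2 ?_⟩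
      exact hzt.imp Eq.symm fun h => (G.mem_neighborFinset z y).2 (ht.2 z h).symm
  · exact ⟨∅, Nat.zero_le _, fun x s h => absurd ⟨x, s, h⟩ hclaw⟩

/-- If all degrees are at most `6`, then `4 * 7` vertices contain all centres of claws, and at most
`28 * 6 = 168` edges end there. -/
theorem ClawsMeet.exists_deleteEdges (hmeet : ClawsMeet G) (hfin : G.support.Finite)
    (hFG : F ≤ G) (hF : F.IsAcyclic) (v : V) :
    ∃ R : Finset (Sym2 V), R.card ≤ 168 ∧ (R : Set (Sym2 V)) ⊆ G.edgeSet \ F.edgeSet ∧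
      ∃ c ∈ insert v G.support, ∀ x s, IsClaw (G.deleteEdges R) x s → c ∈ insert x (s : Set V) := by
  classical
  have : G.LocallyFinite := fun v =>
    (hfin.subset fun w hw => ⟨v, hw.symm⟩ : (G.neighborSet v).Finite).fintype
  by_cases hdeg : ∃ c, 7 ≤ G.degree c
  · obtain ⟨c, hc⟩ := hdeg
    have hcG : 0 < G.degree c := by omega
    refine ⟨∅, Nat.zero_le _, by simp, c, .inr ?_, fun x s h =>
      hmeet.mem_of_seven_le_degree hc (h.mono (G.deleteEdges_le _))⟩
    exact (G.degree_pos_iff_exists_adj c).1 hcG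
  push Not at hdeg
  obtain ⟨c, hc, hclaw⟩ := (hmeet.mono hFG).exists_common_vertex hF
    (hfin.subset (support_mono hFG)) v
  obtain ⟨B, hB, hcenter⟩ := hmeet.exists_finset_centers fun v => Nat.le_of_lt_succ (hdeg v)
  refine ⟨(B.biUnion fun b => G.incidenceFinset b).filter (· ∉ F.edgeSet), ?_, ?_, c,
    Set.insert_subset_insert (support_mono hFG) hc, fun x s h => hclaw x s ⟨h.1, fun y hy => ?_⟩⟩
  · refine (Finset.card_filter_le _ _).trans ((Finset.card_biUnion_le_card_mul _ _ 6
      fun b _ => ?_).trans (Nat.mul_le_mul_right 6 hB))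
    rw [card_incidenceFinset_eq_degree]
    exact Nat.le_of_lt_succ (hdeg b)
  · intro e he
    obtain ⟨he, heF⟩ := Finset.mem_filter.1 he
    obtain ⟨b, -, hb⟩ := Finset.mem_biUnion.1 he
    exact ⟨G.incidenceSet_subset b ((G.mem_incidenceFinset b e).1 hb), heF⟩
  · obtain ⟨hxy, hR⟩ := deleteEdges_adj.1 (h.2 y hy)
    by_contra hF
    refine hR (Finset.mem_filter.2 ⟨Finset.mem_biUnion.2 ⟨x, hcenter x s (h.mono
      (G.deleteEdges_le _)), ?_⟩, hF⟩)
    rw [mem_incidenceFinset]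
    exact G.mk'_mem_incidenceSet_left_iff.2 hxy

end Claws

section Traversals

variable {V : Type*} {G H T F : SimpleGraph V} {L L' : List V} {x y u v w : V}

theorem mem_of_reachable {U : Set V} (hU : ∀ u ∈ U, ∀ w, G.Adj u w → w ∈ U) (hu : u ∈ U)
    (h : G.Reachable u w) : w ∈ U := by
  obtain ⟨p⟩ := h
  induction p with
  | nil => exact hu
  | cons hadj _ ih => exact ih (hU _ hu _ hadj)

theorem reachable_of_isChain (h : L.IsChain G.Adj) (hu : u ∈ L) (hv : v ∈ L) :
    G.Reachable u v := by
  have : Std.Symm G.Reachable := ⟨fun _ _ h => h.symm⟩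
  have : Trans G.Reachable G.Reachable G.Reachable := ⟨Reachable.trans⟩
  exact (List.isChain_iff_pairwise.1 (h.imp fun _ _ => Adj.reachable)).forall_of_forall
    (fun _ _ => .rfl) hu hv

/-- A list that runs along a walk of `G` and contains all neighbours of its members. -/
def IsTraversal (G : SimpleGraph V) (L : List V) : Prop :=
  L.IsChain G.Adj ∧ ∀ u ∈ L, ∀ w, G.Adj u w → w ∈ L

theorem IsTraversal.mem_iff_reachable (hL : IsTraversal G L) (hv : v ∈ L) :
    u ∈ L ↔ G.Reachable v u :=
  ⟨reachable_of_isChain hL.1 hv, mem_of_reachable (U := {u | u ∈ L}) hL.2 hv⟩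

theorem IsTraversal.of_reachable_eq (hle : T ≤ H) (heq : T.Reachable = H.Reachable)
    (hL : IsTraversal T L) : IsTraversal H L := by
  refine ⟨hL.1.imp fun _ _ h => hle h, fun u hu w huw => (hL.mem_iff_reachable hu).2 ?_⟩
  rw [heq]
  exact huw.reachable

theorem mem_insert_support_of_reachable (h : G.Reachable v u) : u ∈ insert v G.support := by
  obtain ⟨p⟩ := h.symm
  cases p with
  | nil => exact .inl rfl
  | cons hadj p => exact .inr ⟨_, hadj⟩

theorem exists_longest_nodup_chain (hfin : G.support.Finite) (v : V) :
    ∃ L : List V, (L.Nodup ∧ L.IsChain G.Adj ∧ v ∈ L) ∧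
      ∀ L' : List V, L'.Nodup → L'.IsChain G.Adj → v ∈ L' → L'.length ≤ L.length := by
  classical
  let lengths : Set ℕ := List.length '' {L | L.Nodup ∧ L.IsChain G.Adj ∧ v ∈ L}
  have hbdd : BddAbove lengths := by
    refine ⟨(hfin.insert v).toFinset.card, ?_⟩
    rintro _ ⟨L, ⟨hnd, hch, hv⟩, rfl⟩
    rw [← List.toFinset_card_of_nodup hnd]
    refine Finset.card_le_card fun u hu => (Set.Finite.mem_toFinset _).2 ?_
    exact mem_insert_support_of_reachable (reachable_of_isChain hch hv (List.mem_toFinset.1 hu))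
  obtain ⟨L, hL, hlen⟩ := Nat.sSup_mem (s := lengths)
    ⟨_, [v], ⟨List.nodup_singleton v, .singleton v, List.mem_singleton_self v⟩, rfl⟩ hbdd
  exact ⟨L, hL, fun L' hnd hch hv => hlen ▸ le_csSup hbdd ⟨L', ⟨hnd, hch, hv⟩, rfl⟩⟩

/-- A longest path through `v` is closed under adjacency: an end vertex has no further neighbour by
maximality, an inner vertex has none since it would be the centre of a claw. -/
theorem exists_isTraversal (hfin : G.support.Finite) (hG : ∀ x s, ¬ IsClaw G x s) (v : V) :
    ∃ L, IsTraversal G L ∧ L.Nodup ∧ v ∈ L := by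
  obtain ⟨L, ⟨hnd, hch, hv⟩, hmax⟩ := exists_longest_nodup_chain hfin v
  refine ⟨L, ⟨hch, fun u hu w huw => ?_⟩, hnd, hv⟩
  by_contra hw
  obtain ⟨l₁, l₂, rfl⟩ := List.append_of_mem hu
  rcases List.eq_nil_or_concat l₁ with rfl | ⟨l₁, a, rfl⟩
  · have := hmax (w :: u :: l₂) (List.nodup_cons.2 ⟨hw, hnd⟩)
      (List.isChain_cons_cons.2 ⟨huw.symm, hch⟩) (List.mem_cons_of_mem _ hv)
    simp at this
  rw [List.concat_eq_append, List.append_assoc, List.singleton_append] at *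
  cases l₂ with
  | nil =>
    have hch' : (l₁ ++ [a, u, w]).IsChain G.Adj := by
      simp only [List.isChain_append, List.isChain_cons_cons] at hch ⊢
      exact ⟨hch.1, ⟨hch.2.1.1, huw, .singleton w⟩, hch.2.2⟩
    have := hmax (l₁ ++ [a, u, w]) (by grind) hch' (by grind)
    simp at this
  | cons b l₂ =>
    have hmid := (List.isChain_append.1 hch).2.1
    simp only [List.isChain_cons_cons] at hmid
    have hwb : w = b := eq_of_adj_of_forall_not_isClaw hG hmid.1.symm huw hmid.2.1 (by grind)
      (by grind)
    exact hw (by simp [hwb])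

/-- Otherwise the chain from `x` to `w` would close a cycle. -/
theorem eq_of_adj_of_isChain (hT : T.IsAcyclic) {l : List V} (hch : (x :: y :: l).IsChain T.Adj)
    (hnd : (x :: y :: l).Nodup) (hw : w ∈ y :: l) (hxw : T.Adj x w) : w = y := by
  classical
  obtain ⟨hxy, hch⟩ := List.isChain_cons_cons.1 hch
  obtain ⟨hx, hnd⟩ := List.nodup_cons.1 hnd
  let p := Walk.ofSupport (y :: l) (List.cons_ne_nil y l) hch
  have hsupp : p.support = y :: l := Walk.support_ofSupport _ _
  have hp : p.IsPath := p.isPath_def.2 (hsupp.symm ▸ hnd)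
  have hwp : w ∈ p.support := hsupp.symm ▸ hw
  have hq : (Walk.cons hxy (p.takeUntil w hwp)).IsPath := (Walk.cons_isPath_iff _ _).2
    ⟨hp.takeUntil hwp, fun h => hx (hsupp ▸ p.support_takeUntil_subset_support hwp h)⟩
  have heq := (hT.subsingleton_path x w).elim ⟨_, hq⟩ (Path.singleton hxw)
  have hsnd := congrArg (fun q : T.Path x w => q.1.snd) heq
  simpa using hsnd.symm

/-- The segments are the maximal `F`-chains; adjacent vertices of `L` are neighbours on `L`. -/
theorem exists_partition_of_isAcyclic (hT : T.IsAcyclic) (hF : F ≤ T) (hch : L.IsChain T.Adj)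
    (hnd : L.Nodup) :
    ∃ P : List (List V), P.flatten = L ∧ (∀ s ∈ P, s ≠ [] ∧ s.IsChain F.Adj) ∧
      P.Pairwise fun s t => ∀ u ∈ s, ∀ w ∈ t, ¬ F.Adj u w := by
  induction L with
  | nil => exact ⟨[], rfl, by simp, .nil⟩
  | cons x L ih =>
    obtain ⟨P, rfl, hP, hsep⟩ := ih hch.of_cons hnd.of_cons
    rcases P with _ | ⟨s, P⟩
    · exact ⟨[[x]], rfl, by simp, List.pairwise_singleton _ _⟩
    obtain ⟨⟨hs, hsch⟩, hP'⟩ := List.forall_mem_cons.1 hP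
    obtain ⟨y, s, rfl⟩ := List.exists_cons_of_ne_nil hs
    have huniq : ∀ w ∈ ((y :: s) :: P).flatten, F.Adj x w → w = y := fun w hw hxw =>
      eq_of_adj_of_isChain hT hch hnd hw (hF hxw)
    by_cases hxy : F.Adj x y
    · refine ⟨(x :: y :: s) :: P, rfl, List.forall_mem_cons.2
        ⟨⟨List.cons_ne_nil _ _, List.isChain_cons_cons.2 ⟨hxy, hsch⟩⟩, hP'⟩, ?_⟩
      obtain ⟨hsep₁, hsep₂⟩ := List.pairwise_cons.1 hsep
      have hyP : ∀ t ∈ P, y ∉ t := fun t ht hyt => by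
        have := hnd.of_cons
        simp only [List.flatten_cons, List.cons_append, List.nodup_cons, List.mem_append] at this
        exact this.1 (.inr (List.mem_flatten_of_mem ht hyt))
      refine List.pairwise_cons.2 ⟨fun t ht => List.forall_mem_cons.2 ⟨fun w hw hxw => ?_,
        hsep₁ t ht⟩, hsep₂⟩
      exact hyP t ht (huniq w (by simp; grind) hxw ▸ hw)
    · refine ⟨[x] :: (y :: s) :: P, rfl, List.forall_mem_cons.2
        ⟨⟨List.cons_ne_nil _ _, .singleton x⟩, hP⟩,
        List.pairwise_cons.2 ⟨fun t ht u hu w hw hxw => ?_, hsep⟩⟩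
      obtain rfl := List.mem_singleton.1 hu
      exact hxy (huniq w (List.mem_flatten_of_mem ht hw) hxw ▸ hxw)

end Traversals

section Residual

variable {M : List (List Bool)} {S R : List (ℕ × ℕ)} {c i j v : ℕ} {s L : List ℕ}
  {G : SimpleGraph ℕ}

/-- `M` is the adjacency matrix of `G`, whose vertices `M.length, M.length + 1, …` are isolated. -/
def IsAdjMatrix (M : List (List Bool)) (G : SimpleGraph ℕ) : Prop :=
  ∀ i j, adjEntry M i j = true ↔ G.Adj i j

theorem IsAdjMatrix.lt_length (hM : IsAdjMatrix M G) (h : G.Adj i j) : i < M.length := by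
  by_contra hi
  have := (hM i j).2 h
  rw [adjEntry, List.getD_eq_default _ _ (not_lt.1 hi)] at this
  exact Bool.false_ne_true this

theorem IsAdjMatrix.finite_support (hM : IsAdjMatrix M G) : G.support.Finite :=
  (Set.finite_lt_nat M.length).subset fun _ ⟨_, h⟩ => hM.lt_length h

/-- The residual graph: `G` after deletion of the edges in `R` and of the edges at `c`. -/
def residual (G : SimpleGraph ℕ) (R : List (ℕ × ℕ)) (c : ℕ) : SimpleGraph ℕ :=
  (G.deleteEdges {e | ∃ p ∈ R, s(p.1, p.2) = e}).deleteIncidenceSet c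

theorem residual_adj :
    (residual G R c).Adj i j ↔ G.Adj i j ∧ i ≠ c ∧ j ≠ c ∧ (i, j) ∉ R ∧ (j, i) ∉ R := by
  have hR : (∃ p ∈ R, s(p.1, p.2) = s(i, j)) ↔ (i, j) ∈ R ∨ (j, i) ∈ R := by
    constructor
    · rintro ⟨⟨a, b⟩, hp, h⟩
      rcases Sym2.eq_iff.1 h with ⟨rfl, rfl⟩ | ⟨rfl, rfl⟩
      exacts [.inl hp, .inr hp]
    · rintro (h | h)
      exacts [⟨_, h, rfl⟩, ⟨_, h, Sym2.eq_swap⟩]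
  rw [residual, deleteIncidenceSet_adj, deleteEdges_adj, Set.mem_ofPred_eq, hR]
  tauto

theorem residual_le : residual G R c ≤ G := fun _ _ h => (residual_adj.1 h).1

theorem eq_of_residual_reachable (h : (residual G R c).Reachable v c) : v = c :=
  mem_of_reachable (U := {c}) (fun _ hu _ huw => absurd hu (residual_adj.1 huw).2.1) rfl h.symm

theorem IsAdjMatrix.residualEntry_iff (hM : IsAdjMatrix M G) :
    residualEntry M R c i j = true ↔ (residual G R c).Adj i j := by
  simp [residualEntry, residual_adj, hM i j, and_assoc]

theorem IsAdjMatrix.isTraversal_iff (hM : IsAdjMatrix M G) :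
    isTraversal M R c L = true ↔ IsTraversal (residual G R c) L := by
  rw [isTraversal, Bool.and_eq_true, IsTraversal, List.isChain_iff_getElem]
  simp only [List.all_eq_true, List.mem_range, Bool.or_eq_true, Bool.not_eq_true',
    List.contains_iff_mem, ← Bool.not_eq_true, hM.residualEntry_iff, ← imp_iff_not_or]
  refine and_congr ?_ (forall₂_congr fun u _ => forall_congr' fun w => ?_)
  · refine forall_congr' fun i => ⟨fun h hi => ?_, fun h hi => ?_⟩
    · simpa [hi, Nat.lt_of_succ_lt hi] using h (Nat.lt_sub_of_add_lt hi)
    · have hi' := Nat.add_lt_of_lt_sub hi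
      simpa [hi', Nat.lt_of_succ_lt hi'] using h hi'
  · exact ⟨fun h hadj => h (hM.lt_length (residual_le hadj.symm)) hadj, fun h _ => h⟩

theorem IsAdjMatrix.mem_traversals (hM : IsAdjMatrix M G) :
    L ∈ traversals M R c v ↔
      L ∈ explorations M R c ∧ IsTraversal (residual G R c) L ∧ v ∈ L := by
  rw [traversals, List.mem_filter, Bool.and_eq_true, hM.isTraversal_iff, List.contains_iff_mem]

theorem IsAdjMatrix.mem_roots (hM : IsAdjMatrix M G) (hv : v < M.length) (hvc : v ≠ c)
    (hmin : ∀ w, (residual G R c).Reachable v w → v ≤ w) : v ∈ roots M R c := by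
  simp only [roots, List.mem_filter, List.mem_range, Bool.and_eq_true, Bool.not_eq_true',
    beq_eq_false_iff_ne, List.all_eq_true, decide_eq_true_eq]
  exact ⟨hv, hvc, fun L hL w hw =>
    have hL := (hM.mem_traversals.1 hL).2
    hmin w ((hL.1.mem_iff_reachable hL.2).1 hw)⟩

theorem le_of_mem_roots (hv : v ∈ roots M R c) (hL : L ∈ traversals M R c v) (hu : i ∈ L) :
    v ≤ i := by
  have := (List.mem_filter.1 hv).2
  simp only [Bool.and_eq_true, List.all_eq_true, decide_eq_true_eq] at this
  exact this.2 L hL i hu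

theorem separatesNone_iff : separatesNone S s = true ↔ ∀ p ∈ S, p.1 ∈ s ↔ p.2 ∈ s := by
  rw [separatesNone, List.all_eq_true]
  refine forall₂_congr fun p _ => ?_
  rw [beq_iff_eq, Bool.eq_iff_iff, List.contains_iff_mem, List.contains_iff_mem]

end Residual

section Serving

variable {V : Type*} {G F F' : SimpleGraph V} {S : List (V × V)} {c u : V} {L : List V} {k : ℕ}

/-- `G` has a Steiner forest with at most `k` edges, given by its set of edges. -/
def HasSteinerForest (G : SimpleGraph V) (S : List (V × V)) (k : ℕ) : Prop :=
  ∃ E : Finset (Sym2 V), (E : Set (Sym2 V)) ⊆ G.edgeSet ∧ E.card ≤ k ∧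
    ∀ p ∈ S, (fromEdgeSet (E : Set (Sym2 V))).Reachable p.1 p.2

/-- In `F`, the vertex `u` is connected to `c`, or all terminal pairs that contain `u` are
connected. -/
def Served (S : List (V × V)) (c : V) (F : SimpleGraph V) (u : V) : Prop :=
  F.Reachable u c ∨ ∀ p ∈ S, p.1 = u ∨ p.2 = u → F.Reachable p.1 p.2

theorem Served.mono (hF : F ≤ F') (h : Served S c F u) : Served S c F' u :=
  h.imp (Reachable.mono hF) fun h p hp hu => (h p hp hu).mono hF

/-- Some `k` edges of `G` suffice to serve all vertices in `L`. -/
def Servable (G : SimpleGraph V) (S : List (V × V)) (c : V) (L : List V) (k : ℕ) : Prop :=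
  ∃ E : Finset (Sym2 V), (E : Set (Sym2 V)) ⊆ G.edgeSet ∧ E.card ≤ k ∧
    ∀ u ∈ L, Served S c (fromEdgeSet (E : Set (Sym2 V))) u

theorem Servable.flatMap {ι : Type*} {l : List ι} {f : ι → List V} {k : ι → ℕ}
    (h : ∀ i ∈ l, Servable G S c (f i) (k i)) :
    Servable G S c (l.flatMap f) (l.map k).sum := by
  classical
  induction l with
  | nil => exact ⟨∅, by simp, le_rfl, by simp⟩
  | cons i l ih =>
    obtain ⟨hi, hl⟩ := List.forall_mem_cons.1 h
    obtain ⟨E, hE, hcard, hserved⟩ := hi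
    obtain ⟨E', hE', hcard', hserved'⟩ := ih hl
    refine ⟨E ∪ E', ?_, (Finset.card_union_le E E').trans (Nat.add_le_add hcard hcard'),
      fun u hu => ?_⟩
    · rw [Finset.coe_union]
      exact Set.union_subset hE hE'
    · rw [List.flatMap_cons, List.mem_append] at hu
      rcases hu with hu | hu
      · exact (hserved u hu).mono (fromEdgeSet_mono (by simp))
      · exact (hserved' u hu).mono (fromEdgeSet_mono (by simp))

theorem Servable.hasSteinerForest (h : Servable G S c L k)
    (hS : ∀ p ∈ S, (p.1 = c ∨ p.1 ∈ L) ∧ (p.2 = c ∨ p.2 ∈ L)) : HasSteinerForest G S k := by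
  obtain ⟨E, hE, hcard, hserved⟩ := h
  have hserved' : ∀ u, u = c ∨ u ∈ L → Served S c (fromEdgeSet (E : Set (Sym2 V))) u := by
    rintro u (rfl | hu)
    exacts [.inl .rfl, hserved u hu]
  refine ⟨E, hE, hcard, fun p hp => ?_⟩
  rcases hserved' p.1 (hS p hp).1 with h₁ | h₁
  · rcases hserved' p.2 (hS p hp).2 with h₂ | h₂
    exacts [h₁.trans h₂.symm, h₂ p hp (.inr rfl)]
  · exact h₁ p hp (.inl rfl)

theorem exists_edges_of_isChain (h : L.IsChain G.Adj) :
    ∃ E : Finset (Sym2 V), (E : Set (Sym2 V)) ⊆ G.edgeSet ∧ E.card ≤ L.length - 1 ∧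
      L.IsChain (fromEdgeSet (E : Set (Sym2 V))).Adj := by
  classical
  rcases eq_or_ne L [] with rfl | hL
  · exact ⟨∅, by simp, by simp, .nil⟩
  let p := Walk.ofSupport L hL h
  have hmem : ∀ e ∈ p.edges, e ∈ (fromEdgeSet (p.edges.toFinset : Set (Sym2 V))).edgeSet := by
    intro e he
    rw [edgeSet_fromEdgeSet]
    exact ⟨by simpa using he, G.not_isDiag_of_mem_edgeSet (p.edges_subset_edgeSet he)⟩
  refine ⟨p.edges.toFinset, ?_, ?_, ?_⟩
  · exact fun e he => p.edges_subset_edgeSet (by simpa using he)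
  · exact (List.toFinset_card_le _).trans_eq (by rw [Walk.length_edges, Walk.length_ofSupport])
  · have := (p.transfer _ hmem).isChain_adj_support
    rwa [Walk.support_transfer, Walk.support_ofSupport] at this

end Serving

section Soundness

variable {M : List (List Bool)} {S R : List (ℕ × ℕ)} {c v : ℕ} {s L : List ℕ} {G : SimpleGraph ℕ}

theorem IsAdjMatrix.servable_segment (hM : IsAdjMatrix M G) (hs : s.IsChain G.Adj)
    (hlt : segmentCost M S c s < infiniteCost M) :
    Servable G S c s (segmentCost M S c s) := by
  obtain ⟨E, hE, hcard, hch⟩ := exists_edges_of_isChain hs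
  have hreach := fun u hu v hv => reachable_of_isChain (u := u) (v := v) hch hu hv
  unfold segmentCost at hlt ⊢
  by_cases hsep : separatesNone S s = true
  · rw [hsep, cond_true]
    rw [separatesNone_iff] at hsep
    refine ⟨E, hE, hcard, fun u hu => .inr fun p hp => ?_⟩
    rintro (rfl | rfl)
    exacts [hreach _ hu _ ((hsep p hp).1 hu), hreach _ ((hsep p hp).2 hu) _ hu]
  · rw [Bool.not_eq_true] at hsep
    by_cases hadj : s.any (adjEntry M c) = true
    · rw [hsep, hadj, cond_false, cond_true]
      obtain ⟨x, hx, hcx⟩ := List.any_eq_true.1 hadj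
      rw [hM] at hcx
      refine ⟨insert s(c, x) E, ?_, ?_, fun u hu => .inl ?_⟩
      · rw [Finset.coe_insert]
        exact Set.insert_subset hcx hE
      · have := List.length_pos_of_mem hx
        exact (Finset.card_insert_le _ _).trans (by omega)
      · refine ((hreach u hu x hx).mono (fromEdgeSet_mono (by simp))).trans (Adj.reachable ?_)
        simp [hcx.ne', Sym2.eq_swap]
    · simp [hsep, hadj] at hlt

theorem IsAdjMatrix.servable_partitionCost (hM : IsAdjMatrix M G) (hL : L.IsChain G.Adj)
    (hlt : partitionCost (segmentCost M S c) (infiniteCost M) L < infiniteCost M) :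
    Servable G S c L (partitionCost (segmentCost M S c) (infiniteCost M) L) := by
  obtain ⟨P, rfl, hne, hsum⟩ := exists_partition_of_partitionCost_lt hlt
  rw [← hsum] at hlt ⊢
  rw [← List.flatMap_id]
  have hchain := ((List.isChain_flatten fun h => hne [] h rfl).1 hL).1
  exact .flatMap fun s hs => hM.servable_segment (hchain s hs)
    ((List.single_le_sum (fun _ _ => Nat.zero_le _) _ (List.mem_map_of_mem hs)).trans_lt hlt)

theorem IsAdjMatrix.exists_traversal_servable (hM : IsAdjMatrix M G)
    (hlt : componentCost M S R c v < infiniteCost M) :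
    ∃ L, IsTraversal (residual G R c) L ∧ v ∈ L ∧
      Servable G S c L (componentCost M S R c v) := by
  obtain ⟨L, hL, hcost⟩ := List.mem_map.1 (minimumWith_mem_of_lt hlt)
  obtain ⟨-, hL, hv⟩ := hM.mem_traversals.1 hL
  rw [componentCost] at hlt ⊢
  rw [← hcost] at hlt ⊢
  exact ⟨L, hL, hv, hM.servable_partitionCost (hL.1.imp fun _ _ h => residual_le h) hlt⟩

/-- Every vertex other than `c` lies on the traversal chosen for the least vertex of its
component. -/
theorem IsAdjMatrix.hasSteinerForest_totalCost (hM : IsAdjMatrix M G)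
    (hS : ∀ p ∈ S, p.1 < M.length ∧ p.2 < M.length)
    (hlt : totalCost M S R c < infiniteCost M) : HasSteinerForest G S (totalCost M S R c) := by
  have hroot : ∀ v ∈ roots M R c, ∃ L, IsTraversal (residual G R c) L ∧ v ∈ L ∧
      Servable G S c L (componentCost M S R c v) := fun v hv =>
    hM.exists_traversal_servable <|
      (List.single_le_sum (fun _ _ => Nat.zero_le _) _ (List.mem_map_of_mem hv)).trans_lt hlt
  choose! f hf hmem hservable using hroot
  have hcover : ∀ u < M.length, u = c ∨ u ∈ (roots M R c).flatMap f := fun u hu => by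
    rcases eq_or_ne u c with huc | huc
    · exact .inl huc
    let m := sInf {w : ℕ | (residual G R c).Reachable u w}
    have hm : (residual G R c).Reachable u m :=
      Nat.sInf_mem (s := {w | (residual G R c).Reachable u w}) ⟨u, Reachable.refl u⟩
    have hmu : m ≤ u := Nat.sInf_le (show (residual G R c).Reachable u u from Reachable.refl u)
    have hmc : m ≠ c := fun h => huc (eq_of_residual_reachable (h ▸ hm))
    have hroot := hM.mem_roots (hmu.trans_lt hu) hmc fun w hw => Nat.sInf_le (hm.trans hw)
    exact .inr (List.mem_flatMap.2 ⟨m, hroot,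
      ((hf m hroot).mem_iff_reachable (hmem m hroot)).2 hm.symm⟩)
  exact (Servable.flatMap hservable).hasSteinerForest fun p hp =>
    ⟨hcover _ (hS p hp).1, hcover _ (hS p hp).2⟩

end Soundness

section Exploration

variable {M : List (List Bool)} {R : List (ℕ × ℕ)} {c a b d v u : ℕ} {l m L : List ℕ}
  {G : SimpleGraph ℕ}

theorem IsAdjMatrix.extend_of_isTraversal (hM : IsAdjMatrix M G)
    (hL : IsTraversal (residual G R c) L) (hne : L ≠ []) : extend M R c L = L := by
  obtain ⟨a, l, rfl⟩ := List.exists_cons_of_ne_nil hne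
  rw [extend, List.append_left_eq_self, List.filter_eq_nil_iff]
  intro w _ hw
  rw [Bool.and_eq_true, List.headD_cons, hM.residualEntry_iff, Bool.not_eq_true',
    ← Bool.not_eq_true, List.contains_iff_mem] at hw
  exact hw.2 (hL.2 a List.mem_cons_self w hw.1)

theorem IsAdjMatrix.extend_cons_cons (hM : IsAdjMatrix M G)
    (hH : ∀ x s, ¬ IsClaw (residual G R c) x s)
    (hch : (a :: b :: d :: l).IsChain (residual G R c).Adj) (hnd : (a :: b :: d :: l).Nodup) :
    extend M R c (b :: d :: l) = a :: b :: d :: l := by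
  simp only [List.isChain_cons_cons] at hch
  obtain ⟨ha, _⟩ := List.nodup_cons.1 hnd
  have hfilter : ∀ w, (residualEntry M R c b w && !(b :: d :: l).contains w) = (w == a) := by
    intro w
    rw [Bool.eq_iff_iff, Bool.and_eq_true, hM.residualEntry_iff, Bool.not_eq_true',
      ← Bool.not_eq_true, List.contains_iff_mem, beq_iff_eq]
    constructor
    · rintro ⟨hbw, hw⟩
      exact (eq_of_adj_of_forall_not_isClaw hH hch.2.1 hbw hch.1.symm (by grind) (by grind))
    · rintro rfl
      exact ⟨hch.1.symm, ha⟩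
  rw [extend, List.headD_cons, List.filter_congr fun w _ => hfilter w, List.filter_beq,
    List.count_eq_one_of_mem List.nodup_range
      (List.mem_range.2 (hM.lt_length (residual_le hch.1)))]
  rfl

theorem IsAdjMatrix.iterate_extend (hM : IsAdjMatrix M G)
    (hH : ∀ x s, ¬ IsClaw (residual G R c) x s)
    (hch : (m ++ [v, u]).IsChain (residual G R c).Adj) (hnd : (m ++ [v, u]).Nodup) :
    (extend M R c)^[m.length] [v, u] = m ++ [v, u] := by
  induction m with
  | nil => rfl
  | cons a m ih =>
    rw [List.length_cons, Function.iterate_succ_apply', ih hch.of_cons hnd.of_cons]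
    rcases m with _ | ⟨b, _ | ⟨d, m⟩⟩ <;> exact hM.extend_cons_cons hH hch hnd

theorem IsAdjMatrix.mem_explorations (hM : IsAdjMatrix M G)
    (hH : ∀ x s, ¬ IsClaw (residual G R c) x s) (hL : IsTraversal (residual G R c) L)
    (hnd : L.Nodup) (hne : L ≠ []) (hlt : ∀ u ∈ L, u < M.length) : L ∈ explorations M R c := by
  have hlen : L.length ≤ M.length := by
    simpa using (hnd.subperm fun u hu => List.mem_range.2 (hlt u hu)).length_le
  simp only [explorations, List.mem_flatMap, List.mem_range, List.mem_cons, List.mem_map]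
  obtain ⟨L, u, rfl⟩ := (List.eq_nil_or_concat L).resolve_left hne
  refine ⟨u, hlt u (by simp), ?_⟩
  rcases List.eq_nil_or_concat L with rfl | ⟨m, v, rfl⟩
  · exact .inl rfl
  rw [List.concat_eq_append, List.concat_eq_append, List.append_assoc,
    List.singleton_append] at *
  have hm : m.length ≤ M.length := by
    rw [List.length_append] at hlen
    omega
  refine .inr ⟨v, hlt v (by simp), ?_⟩
  rw [← Nat.sub_add_cancel hm, Function.iterate_add_apply, hM.iterate_extend hH hL.1 hnd]
  exact Function.iterate_fixed (hM.extend_of_isTraversal hL hne) _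

end Exploration

section EdgesIn

variable {V : Type*} {F : SimpleGraph V} {E : Finset (Sym2 V)} {c u : V} {s : List V}

open Classical in
/-- The edges in `E` between members of `s` and from these to `c`. -/
noncomputable def edgesIn (E : Finset (Sym2 V)) (c : V) (s : List V) : Finset (Sym2 V) :=
  E.filter fun e => ∀ u ∈ e, u ∈ s ∨ u = c

theorem mem_edgesIn {e : Sym2 V} :
    e ∈ edgesIn E c s ↔ e ∈ E ∧ ∀ u ∈ e, u ∈ s ∨ u = c := by
  classical
  exact Finset.mem_filter

theorem sum_card_edgesIn_le (hF : F.edgeSet = E) {ι : Type*} {l : List ι} {f : ι → List V}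
    (hf : l.Pairwise (Function.onFun List.Disjoint f)) :
    (l.map fun i => (edgesIn E c (f i)).card).sum ≤ (edgesIn E c (l.flatMap f)).card := by
  classical
  induction l with
  | nil => simp
  | cons i l ih =>
    obtain ⟨hi, hl⟩ := List.pairwise_cons.1 hf
    have hdisj : Disjoint (edgesIn E c (f i)) (edgesIn E c (l.flatMap f)) := by
      rw [Finset.disjoint_left]
      intro e he he'
      rw [mem_edgesIn] at he he'
      have hc : ∀ u ∈ e, u = c := fun u hu => by
        by_contra huc
        obtain ⟨j, hj, huj⟩ := List.mem_flatMap.1 ((he'.2 u hu).resolve_right huc)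
        exact hi j hj ((he.2 u hu).resolve_right huc) huj
      have heF : e ∈ F.edgeSet := hF ▸ he.1
      induction e with
      | h x y =>
        exact heF.ne ((hc x (Sym2.mem_mk_left x y)).trans (hc y (Sym2.mem_mk_right x y)).symm)
    rw [List.map_cons, List.sum_cons, List.flatMap_cons]
    refine (Nat.add_le_add_left (ih hl) _).trans ?_
    rw [← Finset.card_union_of_disjoint hdisj]
    refine Finset.card_le_card fun e he => ?_
    simp only [Finset.mem_union, mem_edgesIn, List.mem_append] at he ⊢
    grind

theorem length_sub_one_le_card_edgesIn (hF : F.edgeSet = E) (hs : s.IsChain F.Adj)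
    (hnd : s.Nodup) : s.length - 1 ≤ (edgesIn E c s).card := by
  classical
  rcases eq_or_ne s [] with rfl | hne
  · exact Nat.zero_le _
  let p := Walk.ofSupport s hne hs
  have hsupp : p.support = s := Walk.support_ofSupport _ _
  have hp : p.edges.Nodup := (p.isPath_def.2 (hsupp.symm ▸ hnd)).isTrail.edges_nodup
  rw [← Walk.length_ofSupport hne hs, ← Walk.length_edges, ← List.toFinset_card_of_nodup hp]
  refine Finset.card_le_card fun e he => mem_edgesIn.2 ⟨?_, fun u hu => .inl ?_⟩
  · rw [← Finset.mem_coe, ← hF]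
    exact p.edges_subset_edgeSet (List.mem_toFinset.1 he)
  · exact hsupp ▸ p.mem_support_of_mem_edges (List.mem_toFinset.1 he) hu

theorem length_le_card_edgesIn (hF : F.edgeSet = E) (hs : s.IsChain F.Adj) (hnd : s.Nodup)
    (hc : c ∉ s) (hu : u ∈ s) (hcu : F.Adj c u) : s.length ≤ (edgesIn E c s).card := by
  classical
  have hE : s(c, u) ∈ E := by rwa [← Finset.mem_coe, ← hF]
  have hnot : s(c, u) ∉ edgesIn E u s := fun h =>
    ((mem_edgesIn.1 h).2 c (Sym2.mem_mk_left c u)).elim hc fun h => hc (h ▸ hu)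
  have hsub : insert s(c, u) (edgesIn E u s) ⊆ edgesIn E c s := by
    refine Finset.insert_subset (mem_edgesIn.2 ⟨hE, fun x hx => ?_⟩) fun e he => ?_
    · rcases Sym2.mem_iff.1 hx with rfl | rfl
      exacts [.inr rfl, .inl hu]
    · rw [mem_edgesIn] at he ⊢
      exact ⟨he.1, fun x hx => .inl ((he.2 x hx).elim id fun h => h ▸ hu)⟩
  have := length_sub_one_le_card_edgesIn (c := u) hF hs hnd
  have := Finset.card_le_card hsub
  rw [Finset.card_insert_of_notMem hnot] at this
  omega

end EdgesIn

section Completeness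

variable {M : List (List Bool)} {S R : List (ℕ × ℕ)} {c v : ℕ} {s L : List ℕ}
  {G F T : SimpleGraph ℕ} {E : Finset (Sym2 ℕ)}

theorem IsAdjMatrix.segmentCost_le (hM : IsAdjMatrix M G) (hFG : F ≤ G) (hF : F.edgeSet = E)
    (hS : ∀ p ∈ S, F.Reachable p.1 p.2) (hs : s.IsChain F.Adj) (hnd : s.Nodup) (hc : c ∉ s)
    (hclosed : ∀ u ∈ s, ∀ w, F.Adj u w → w = c ∨ w ∈ s) :
    segmentCost M S c s ≤ (edgesIn E c s).card := by
  unfold segmentCost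
  by_cases hcu : ∃ u ∈ s, F.Adj c u
  · obtain ⟨u, hu, hcu⟩ := hcu
    have hlen := length_le_card_edgesIn hF hs hnd hc hu hcu
    rw [List.any_eq_true.2 ⟨u, hu, (hM c u).2 (hFG hcu)⟩]
    cases separatesNone S s
    exacts [hlen, (Nat.sub_le _ _).trans hlen]
  · have hclosed' : ∀ u ∈ {u | u ∈ s}, ∀ w, F.Adj u w → w ∈ {u | u ∈ s} := fun u hu w huw =>
      (hclosed u hu w huw).resolve_left fun h => hcu ⟨u, hu, h ▸ huw.symm⟩
    have hsep : separatesNone S s = true := separatesNone_iff.2 fun p hp =>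
      ⟨fun h => mem_of_reachable (U := {u | u ∈ s}) hclosed' h (hS p hp), fun h =>
        mem_of_reachable (U := {u | u ∈ s}) hclosed' h (hS p hp).symm⟩
    rw [hsep, cond_true]
    exact length_sub_one_le_card_edgesIn hF hs hnd

theorem IsAdjMatrix.partitionCost_le (hM : IsAdjMatrix M G) (hFG : F ≤ G) (hF : F.edgeSet = E)
    (hS : ∀ p ∈ S, F.Reachable p.1 p.2) (hT : T.IsAcyclic) (hFT : F.deleteIncidenceSet c ≤ T)
    (hL : IsTraversal T L) (hnd : L.Nodup) (hc : c ∉ L) :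
    partitionCost (segmentCost M S c) (infiniteCost M) L ≤ (edgesIn E c L).card := by
  obtain ⟨P, rfl, hP, hsep⟩ := exists_partition_of_isAcyclic hT hFT hL.1 hnd
  obtain ⟨hnds, hdisj⟩ := List.nodup_flatten.1 hnd
  have : Std.Symm fun s t : List ℕ => ∀ u ∈ s, ∀ w ∈ t, ¬ (F.deleteIncidenceSet c).Adj u w :=
    ⟨fun _ _ h u hu w hw huw => h w hw u hu huw.symm⟩
  have hclosed : ∀ s ∈ P, ∀ u ∈ s, ∀ w, F.Adj u w → w = c ∨ w ∈ s := by
    intro s hs u hu w huw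
    refine or_iff_not_imp_left.2 fun hwc => ?_
    have huc : u ≠ c := fun h => hc (h ▸ List.mem_flatten_of_mem hs hu)
    have huw' : (F.deleteIncidenceSet c).Adj u w :=
      (deleteIncidenceSet_adj ..).2 ⟨huw, huc, hwc⟩
    obtain ⟨t, ht, hwt⟩ :=
      List.mem_flatten.1 (hL.2 u (List.mem_flatten_of_mem hs hu) w (hFT huw'))
    by_contra hws
    exact hsep.forall hs ht (fun h => hws (h ▸ hwt)) u hu w hwt huw'
  have hcost : ∀ s ∈ P, segmentCost M S c s ≤ (edgesIn E c s).card := fun s hs =>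
    hM.segmentCost_le hFG hF hS ((hP s hs).2.imp fun _ _ h => deleteIncidenceSet_le _ _ h)
      (hnds s hs) (fun h => hc (List.mem_flatten_of_mem hs h)) (hclosed s hs)
  calc partitionCost (segmentCost M S c) (infiniteCost M) P.flatten
      ≤ (P.map (segmentCost M S c)).sum := partitionCost_flatten_le fun s hs => (hP s hs).1
    _ ≤ (P.map fun s => (edgesIn E c s).card).sum := List.sum_le_sum hcost
    _ ≤ (edgesIn E c (P.flatMap id)).card := sum_card_edgesIn_le hF hdisj
    _ = (edgesIn E c P.flatten).card := by rw [List.flatMap_id]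

theorem IsAdjMatrix.exists_traversal_partitionCost_le (hM : IsAdjMatrix M G) (hFG : F ≤ G)
    (hF : F.edgeSet = E) (hac : F.IsAcyclic) (hS : ∀ p ∈ S, F.Reachable p.1 p.2)
    (hFR : F.deleteIncidenceSet c ≤ residual G R c)
    (hH : ∀ x s, ¬ IsClaw (residual G R c) x s) (hv : v < M.length) (hvc : v ≠ c) :
    ∃ L ∈ traversals M R c v,
      partitionCost (segmentCost M S c) (infiniteCost M) L ≤ (edgesIn E c L).card := by
  obtain ⟨T, hFT, hTH, hT, hreach⟩ :=
    (residual G R c).exists_isAcyclic_reachable_eq_le_of_le_of_isAcyclic hFR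
      (hac.anti (deleteIncidenceSet_le _ _))
  have hTG : T ≤ G := hTH.trans residual_le
  obtain ⟨L, hLT, hnd, hvL⟩ := exists_isTraversal
    (hM.finite_support.subset (support_mono hTG)) (fun x s h => hH x s (h.mono hTH)) v
  have hL := hLT.of_reachable_eq hTH hreach
  have hlt : ∀ u ∈ L, u < M.length := fun u hu => by
    rcases mem_insert_support_of_reachable ((hLT.mem_iff_reachable hvL).1 hu) with rfl | ⟨w, h⟩
    exacts [hv, hM.lt_length (hTG h)]
  refine ⟨L, hM.mem_traversals.2 ⟨?_, hL, hvL⟩, ?_⟩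
  · exact hM.mem_explorations hH hL hnd (List.ne_nil_of_mem hvL) hlt
  · exact hM.partitionCost_le hFG hF hS hT hFT hLT hnd fun hc =>
      hvc (eq_of_residual_reachable ((hL.mem_iff_reachable hvL).1 hc))

theorem IsAdjMatrix.totalCost_le (hM : IsAdjMatrix M G) (hFG : F ≤ G)
    (hF : F.edgeSet = E) (hac : F.IsAcyclic) (hS : ∀ p ∈ S, F.Reachable p.1 p.2)
    (hFR : F.deleteIncidenceSet c ≤ residual G R c)
    (hH : ∀ x s, ¬ IsClaw (residual G R c) x s) : totalCost M S R c ≤ E.card := by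
  have hroot : ∀ v ∈ roots M R c, ∃ L ∈ traversals M R c v,
      partitionCost (segmentCost M S c) (infiniteCost M) L ≤ (edgesIn E c L).card := fun v hv => by
    simp only [roots, List.mem_filter, List.mem_range, Bool.and_eq_true, Bool.not_eq_true',
      beq_eq_false_iff_ne] at hv
    exact hM.exists_traversal_partitionCost_le hFG hF hac hS hFR hH hv.1 hv.2.1
  choose! f hf hcost using hroot
  have hmem : ∀ v ∈ roots M R c, ∀ u, u ∈ f v ↔ (residual G R c).Reachable v u := fun v hv u =>
    have hL := (hM.mem_traversals.1 (hf v hv)).2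
    hL.1.mem_iff_reachable hL.2
  have hle : ∀ v ∈ roots M R c, ∀ w ∈ roots M R c, ∀ u ∈ f v, u ∈ f w → v ≤ w :=
    fun v hv w hw u huv huw => le_of_mem_roots hv (hf v hv) <|
      (hmem v hv w).2 (((hmem v hv u).1 huv).trans ((hmem w hw u).1 huw).symm)
  have hdisj : (roots M R c).Pairwise (Function.onFun List.Disjoint f) :=
    (List.nodup_range.filter _).pairwise_of_forall_ne fun v hv w hw hvw u huv huw =>
      hvw ((hle v hv w hw u huv huw).antisymm (hle w hw v hv u huw huv))
  calc totalCost M S R c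
      ≤ ((roots M R c).map fun v => (edgesIn E c (f v)).card).sum :=
        List.sum_le_sum fun v hv => (minimumWith_le_of_mem (List.mem_map_of_mem (hf v hv))).trans
          (hcost v hv)
    _ ≤ (edgesIn E c ((roots M R c).flatMap f)).card := sum_card_edgesIn_le hF hdisj
    _ ≤ E.card := Finset.card_le_card fun e he => (mem_edgesIn.1 he).1

end Completeness

section Correctness

variable {V : Type*} {H : SimpleGraph V} {x c : V} {s : Finset V} {M : List (List Bool)}
  {S : List (ℕ × ℕ)} {k : ℕ} {G F : SimpleGraph ℕ} {E : Finset (Sym2 ℕ)}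

theorem not_isClaw_deleteIncidenceSet
    (hc : ∀ x s, IsClaw H x s → c ∈ insert x (s : Set V)) :
    ¬ IsClaw (H.deleteIncidenceSet c) x s := by
  intro h
  have hadj := fun y hy => deleteIncidenceSet_adj.1 (h.2 y hy)
  rcases hc x s (h.mono (deleteIncidenceSet_le H c)) with rfl | hcs
  · obtain ⟨y, hy⟩ := Finset.card_pos.1 (h.1 ▸ three_pos)
    exact (hadj y hy).2.1 rfl
  · exact (hadj c hcs).2.2 rfl

theorem HasSteinerForest.exists_isAcyclic {S : List (V × V)} (h : HasSteinerForest H S k) :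
    ∃ F ≤ H, F.IsAcyclic ∧ (∀ p ∈ S, F.Reachable p.1 p.2) ∧
      ∃ E : Finset (Sym2 V), F.edgeSet = E ∧ E.card ≤ k := by
  obtain ⟨E, hE, hcard, hreach⟩ := h
  obtain ⟨F, hFE, hF, heq⟩ := (fromEdgeSet (E : Set (Sym2 V))).exists_isAcyclic_reachable_eq_le
  have hsub : F.edgeSet ⊆ E := (edgeSet_mono hFE).trans (edgeSet_fromEdgeSet _ ▸ Set.sdiff_subset)
  obtain ⟨E', hE'⟩ := (E.finite_toSet.subset hsub).exists_finset_coe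
  refine ⟨F, edgeSet_subset_edgeSet.1 (hsub.trans hE), hF, heq ▸ hreach, E', hE'.symm, ?_⟩
  exact (Finset.card_le_card (Finset.coe_subset.1 (hE' ▸ hsub))).trans hcard

theorem exists_list_residual_eq (R : Finset (Sym2 ℕ)) :
    ∃ L : List (ℕ × ℕ), L.length = R.card ∧ (∀ p ∈ L, s(p.1, p.2) ∈ R) ∧
      ∀ (G : SimpleGraph ℕ) c, residual G L c = (G.deleteEdges R).deleteIncidenceSet c := by
  have hout : ∀ e : Sym2 ℕ, s((Quot.out e).1, (Quot.out e).2) = e := Quot.out_eq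
  refine ⟨R.toList.map Quot.out, by simp, ?_, fun G c => ?_⟩
  · intro p hp
    obtain ⟨e, he, rfl⟩ := List.mem_map.1 hp
    rw [hout]
    exact Finset.mem_toList.1 he
  · have hR : {e | ∃ p ∈ R.toList.map Quot.out, s(p.1, p.2) = e} = (R : Set (Sym2 ℕ)) := by
      ext e
      simp [hout]
    rw [residual, hR]

theorem IsAdjMatrix.exists_residual (hM : IsAdjMatrix M G) (hmeet : ClawsMeet G) (hFG : F ≤ G)
    (hF : F.IsAcyclic) :
    ∃ R ∈ listsUpTo (List.range M.length ×ˢ List.range M.length) 168,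
      ∃ c ∈ List.range (M.length + 1), F.deleteIncidenceSet c ≤ residual G R c ∧
        ∀ x s, ¬ IsClaw (residual G R c) x s := by
  obtain ⟨R, hcard, hR, c, hc, hclaw⟩ :=
    hmeet.exists_deleteEdges hM.finite_support hFG hF M.length
  obtain ⟨L, hlen, hL, hres⟩ := exists_list_residual_eq R
  refine ⟨L, mem_listsUpTo.2 ⟨hlen.trans_le hcard, fun p hp => ?_⟩, c, ?_, ?_, ?_⟩
  · have hadj : G.Adj p.1 p.2 := (hR (hL p hp)).1
    exact List.mem_product.2
      ⟨List.mem_range.2 (hM.lt_length hadj), List.mem_range.2 (hM.lt_length hadj.symm)⟩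
  · rw [List.mem_range, Nat.lt_succ_iff]
    rcases hc with rfl | ⟨w, h⟩
    exacts [le_rfl, (hM.lt_length h).le]
  · intro u w h
    rw [hres, deleteIncidenceSet_adj, deleteEdges_adj]
    rw [deleteIncidenceSet_adj] at h
    exact ⟨⟨hFG h.1, fun huw => (hR huw).2 h.1⟩, h.2⟩
  · exact fun x s => hres G c ▸ not_isClaw_deleteIncidenceSet hclaw

theorem IsAdjMatrix.card_le (hM : IsAdjMatrix M G) (hE : (E : Set (Sym2 ℕ)) ⊆ G.edgeSet) :
    E.card ≤ M.length * M.length := by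
  classical
  have hsub : E ⊆ (Finset.range M.length ×ˢ Finset.range M.length).image fun p => s(p.1, p.2) := by
    intro e he
    induction e with
    | h x y =>
      have hadj : G.Adj x y := hE he
      exact Finset.mem_image.2
        ⟨(x, y), by simp [hM.lt_length hadj, hM.lt_length hadj.symm], rfl⟩
  simpa using (Finset.card_le_card hsub).trans Finset.card_image_le

theorem IsAdjMatrix.solve_iff (hM : IsAdjMatrix M G) (hmeet : ClawsMeet G)
    (hS : ∀ p ∈ S, p.1 < M.length ∧ p.2 < M.length) :
    solve 168 (M, S, k.bits, ()) = true ↔ HasSteinerForest G S k := by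
  simp only [solve, List.any_eq_true, decide_eq_true_eq, cappedValue_bits, le_min_iff]
  constructor
  · rintro ⟨R, -, c, -, hn, hk⟩
    obtain ⟨E, hE, hcard, hreach⟩ := hM.hasSteinerForest_totalCost hS (Nat.lt_succ_iff.2 hn)
    exact ⟨E, hE, hcard.trans hk, hreach⟩
  · intro h
    obtain ⟨F, hFG, hac, hreach, E, hFE, hcard⟩ := h.exists_isAcyclic
    obtain ⟨R, hR, c, hc, hFR, hclaw⟩ := hM.exists_residual hmeet hFG hac
    have hle := hM.totalCost_le hFG hFE hac hreach hFR hclaw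
    exact ⟨R, hR, c, hc, hle.trans (hM.card_le (hFE ▸ edgeSet_mono hFG)), hle.trans hcard⟩

end Correctness

section Transfer

variable {V W : Type*} {G : SimpleGraph V} {f : V ↪ W} {S : List (V × V)} {k : ℕ} {u v : V}

theorem ClawsMeet.map (h : ClawsMeet G) : ClawsMeet (G.map f) := by
  have hlift : ∀ x s, IsClaw (G.map f) x s → ∃ x' s', f x' = x ∧ s'.map f = s ∧ IsClaw G x' s' := by
    classical
    intro x s hs
    obtain ⟨y, hy⟩ := Finset.card_pos.1 (hs.1 ▸ three_pos)
    obtain ⟨x, -, -, rfl, -⟩ := (map_adj ..).1 (hs.2 y hy)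
    obtain ⟨s, hsG, rfl⟩ : ∃ s' : Finset V, (s' : Set V) ⊆ G.neighborSet x ∧ s'.image f = s := by
      refine Finset.subset_set_image_iff.1 fun y hy => ?_
      obtain ⟨x', y', hadj, hx, rfl⟩ := (map_adj ..).1 (hs.2 y hy)
      exact ⟨y', f.injective hx ▸ hadj, rfl⟩
    exact ⟨x, s, rfl, Finset.map_eq_image f s,
      by rw [← hs.1, Finset.card_image_of_injective s f.injective], hsG⟩
  intro x s y t hs ht
  obtain ⟨x, s, rfl, rfl, hs'⟩ := hlift x s hs
  obtain ⟨y, t, rfl, rfl, ht'⟩ := hlift y t ht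
  obtain ⟨z, hz, hz'⟩ := h hs' ht'
  exact ⟨f z, by simpa using hz, by simpa using hz'⟩

theorem reachable_map_iff : (G.map f).Reachable (f u) (f v) ↔ G.Reachable u v := by
  refine ⟨fun h => ?_, fun h => h.map (Embedding.map f G).toHom⟩
  have hU : ∀ x ∈ f '' {w | G.Reachable u w}, ∀ y, (G.map f).Adj x y →
      y ∈ f '' {w | G.Reachable u w} := by
    rintro _ ⟨w, hw, rfl⟩ _ hadj
    obtain ⟨w', z, hw'z, hww', rfl⟩ := (map_adj ..).1 hadj
    exact ⟨z, hw.trans (f.injective hww' ▸ hw'z.reachable), rfl⟩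
  obtain ⟨w, hw, hwv⟩ := mem_of_reachable hU ⟨u, .refl u, rfl⟩ h
  exact f.injective hwv ▸ hw

theorem fromEdgeSet_map (E : Finset (Sym2 V)) :
    fromEdgeSet (E.map f.sym2Map : Set (Sym2 W)) = (fromEdgeSet (E : Set (Sym2 V))).map f := by
  refine edgeSet_injective ?_
  rw [edgeSet_map, edgeSet_fromEdgeSet, edgeSet_fromEdgeSet, Finset.coe_map]
  ext e
  constructor
  · rintro ⟨⟨e, he, rfl⟩, hd⟩
    exact ⟨e, ⟨he, fun h => hd ((Sym2.isDiag_map f.injective).2 h)⟩, rfl⟩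
  · rintro ⟨e, ⟨he, hd⟩, rfl⟩
    exact ⟨⟨e, he, rfl⟩, fun h => hd ((Sym2.isDiag_map f.injective).1 h)⟩

theorem hasSteinerForest_map_iff :
    HasSteinerForest (G.map f) (S.map (Prod.map f f)) k ↔ HasSteinerForest G S k := by
  classical
  have hiff : ∀ E : Finset (Sym2 V),
      ((E.map f.sym2Map : Set (Sym2 W)) ⊆ (G.map f).edgeSet ∧
        (E.map f.sym2Map).card ≤ k ∧ ∀ p ∈ S.map (Prod.map f f),
          (fromEdgeSet (E.map f.sym2Map : Set (Sym2 W))).Reachable p.1 p.2) ↔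
      ((E : Set (Sym2 V)) ⊆ G.edgeSet ∧ E.card ≤ k ∧
        ∀ p ∈ S, (fromEdgeSet (E : Set (Sym2 V))).Reachable p.1 p.2) := by
    intro E
    rw [edgeSet_map, Finset.coe_map, Set.image_subset_image_iff f.sym2Map.injective,
      Finset.card_map, ← Finset.coe_map, fromEdgeSet_map, List.forall_mem_map]
    simp only [Prod.map_fst, Prod.map_snd, reachable_map_iff]
  constructor
  · rintro ⟨E, hE, h⟩
    rw [edgeSet_map, Finset.subset_set_image_iff] at hE
    obtain ⟨E, hE, rfl⟩ := hE
    rw [← Finset.map_eq_image] at h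
    have hE' : (E.map f.sym2Map : Set (Sym2 W)) ⊆ (G.map f).edgeSet := by
      rw [edgeSet_map, Finset.coe_map]
      exact Set.image_mono hE
    exact ⟨E, (hiff E).1 ⟨hE', h⟩⟩
  · rintro ⟨E, h⟩
    exact ⟨E.map f.sym2Map, (hiff E).2 h⟩

end Transfer

section Instances

theorem exists_isSteinerForest_iff {V : Type} [Finite V] {G : SimpleGraph V} {S : List (V × V)}
    {k : ℕ} :
    (∃ F : G.Subgraph, IsSteinerForest G S F ∧ F.edgeSet.ncard ≤ k) ↔ HasSteinerForest G S k := by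
  constructor
  · rintro ⟨F, hF, hk⟩
    have hfin := F.edgeSet.toFinite
    refine ⟨hfin.toFinset, ?_, by rwa [← Set.ncard_eq_toFinset_card], fun p hp => ?_⟩
    · simpa using F.edgeSet_subset
    · obtain ⟨hs, ht, h⟩ := hF p hp
      rw [hfin.coe_toFinset, ← F.edgeSet_spanningCoe, fromEdgeSet_edgeSet]
      exact h.map F.coeEmbeddingSpanningCoe.toHom
  · rintro ⟨E, hE, hk, hreach⟩
    have hle : fromEdgeSet (E : Set (Sym2 V)) ≤ G := fromEdgeSet_edgeSet G ▸ fromEdgeSet_mono hE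
    refine ⟨toSubgraph _ hle, fun p hp => ⟨trivial, trivial, ?_⟩, ?_⟩
    · let f : fromEdgeSet (E : Set (Sym2 V)) →g (toSubgraph _ hle).coe :=
        ⟨fun v => ⟨v, trivial⟩, fun h => h⟩
      exact (hreach p hp).map f
    · refine le_trans ?_ hk
      rw [← Set.ncard_coe_finset E]
      refine Set.ncard_le_ncard ?_ E.finite_toSet
      change (fromEdgeSet (E : Set (Sym2 V))).edgeSet ⊆ E
      rw [edgeSet_fromEdgeSet]
      exact Set.sdiff_subset

variable (I : SteinerInstance)

/-- The data on which `solve` runs. -/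
noncomputable def input : List (List Bool) × List (ℕ × ℕ) × List Bool × Unit :=
  (I.adjMatrixRows, I.pairs.map (Prod.map Fin.valEmbedding Fin.valEmbedding), I.k.bits, ())

theorem toVal_input : TreeEncoding.toVal (input I) = I.encode := by
  simp only [input, TreeEncoding.toVal, SteinerInstance.encode, Val.ofList, Val.ofNatBinary,
    List.map_map]
  rfl

theorem isAdjMatrix_adjMatrixRows :
    IsAdjMatrix I.adjMatrixRows (I.graph.map Fin.valEmbedding) := by
  intro i j
  have hentry : adjEntry I.adjMatrixRows i j = true ↔
      ∃ (hi : i < I.n) (hj : j < I.n), I.graph.Adj ⟨i, hi⟩ ⟨j, hj⟩ := by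
    by_cases hi : i < I.n <;> by_cases hj : j < I.n <;>
      simp [adjEntry, SteinerInstance.adjMatrixRows, hi, hj]
  rw [hentry, map_adj]
  constructor
  · rintro ⟨hi, hj, hadj⟩
    exact ⟨_, _, hadj, rfl, rfl⟩
  · rintro ⟨u, v, hadj, rfl, rfl⟩
    exact ⟨u.2, v.2, hadj⟩

theorem solve_input_iff (h : twoClaws.Free I.graph) :
    solve 168 (input I) = true ↔ I.IsYes := by
  rw [SteinerInstance.IsYes, exists_isSteinerForest_iff,
    ← hasSteinerForest_map_iff (f := Fin.valEmbedding)]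
  refine (isAdjMatrix_adjMatrixRows I).solve_iff (clawsMeet_of_twoClaws_free h).map ?_
  rw [List.forall_mem_map, SteinerInstance.adjMatrixRows, List.length_ofFn]
  exact fun p _ => ⟨p.1.2, p.2.2⟩

end Instances

end SteinerForest

theorem lemma13 :
    WhileLang.PolyTimeSolvableOn SteinerInstance.encode
      (fun I : SteinerInstance => twoClaws.Free I.graph)
      (fun I : SteinerInstance => I.IsYes) :=
  (SteinerForest.polyTime_solve 168).polyTimeSolvableOn SteinerForest.input
    SteinerForest.toVal_input SteinerForest.solve_input_iff
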